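/- Let $G$ be a discrete group and let $O_G$ be the category with objects the orbits $G/H$ ($H\le G$ a subgroup) and morphisms the $G$-maps; a morphism $\hat g:G/H\to G/K$ is given by $g\in G$ with $g^{-1}Hg\subseteq K$, $\hat g(eH)=gK$. $O_G$-simplicial sets, $O_G$-groups and (simplicial) abelian $O_G$-groups are contravariant functors from $O_G$. An action of an $O_G$-group $\underline\pi$ on a contravariant functor $T$ on $O_G$ consists of homomorphisms $\phi_H:\underline\pi(G/H)\to\mathrm{Aut}(T(G/H))$ with $\phi_H(\underline\pi(\hat g)v)\circ T(\hat g)=T(\hat g)\circ\phi_K(v)$ for all $\hat g:G/H\to G/K$ and $v\in\underline\pi(G/K)$. An *equivariant twisted Cartan cohomology theory* $\mathcal A$ consists of simplicial abelian $O_G$-groups $A^i$ ($i\ge 0$) and homomorphisms $\delta^i:A^i\to A^{i+1}$ such that (1) for each $H$, $(A^*(G/H)_*,\delta^*)$ is a simplicial differential graded algebra over $\mathbb Z$ (associative, a unit is not required); (2) for each $p\ge0$ the sequence $A^0_p\to A^1_p\to A^2_p\to\cdots$ of abelian $O_G$-groups is exact; (3) $\pi_n(A^i(G/H))=0$ for all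 $n,i\ge 0$ and all $H$; (4) all face and degeneracy maps of $Z^0\mathcal A=\ker\delta^0$ are isomorphisms; (5) there are homomorphisms $\psi^i_H:\mathrm{Aut}((Z^0\mathcal A)_0(G/H))\to\mathrm{Aut}(A^i(G/H))$ (automorphisms of simplicial groups) with $\delta^i\circ\psi^i_H(\alpha)=\psi^{i+1}_H(\alpha)\circ\delta^i$, and such that $\alpha\circ(Z^0\mathcal A)_0(\hat g)=(Z^0\mathcal A)_0(\hat g)\circ\beta$ implies $\psi^i_H(\alpha)\circ A^i(\hat g)=A^i(\hat g)\circ\psi^i_K(\beta)$. Put $Z^n\mathcal A=\ker\delta^n$ and $M=(Z^0\mathcal A)_0$. Let $X$ be a $G$-simplicial set and $\Phi X$ the $O_G$-simplicial set $\Phi X(G/H)=X^H$, $\Phi X(\hat g)(x)=gx$. Let $\underline\pi$ be an $O_G$-group, $\phi$ an action of $\underline\pi$ on the abelian $O_G$-group $M$, and $\tau:\Phi X\to\underline\pi$ an $O_G$-twisting function: maps $\tau(G/H)_q:X^H_q\to\underline\pi(G/H)$, $q\ge1$, natural in $G/H$, with $$\tau(\partial_1x)=\tau(\partial_0x)\,\tau(x),\qquad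 \tau(\partial_{i+1}x)=\tau(x)\ (i\geq 1),\qquad \tau(s_{i+1}x)=\tau(x)\ (i\ge 0),\qquad \tau(s_0x)=e .$$ Let $\overline W\underline\pi$ be the $O_G$-simplicial set whose $q$-simplices over $G/H$ are the tuples $[x_1,\dots,x_q]$ in $\underline\pi(G/H)$, with $\partial_0[x_1,\dots,x_q]=[x_2,\dots,x_q]$, $\partial_i[x_1,\dots,x_q]=[x_1,\dots,x_{i+1}x_i,\dots,x_q]$ for $0<i<q$, $\partial_q[x_1,\dots,x_q]=[x_1,\dots,x_{q-1}]$, and degeneracies inserting $e$. Let $\tau(\underline\pi):\overline W\underline\pi\to\underline\pi$ be the twisting function $[x_1,\dots,x_q]\mapsto x_1$, and let $\theta(\tau):\Phi X\to\overline W\underline\pi$ be the map $x\mapsto[\tau(x),\tau(\partial_0x),\dots,\tau(\partial_0^{q-1}x)]$. Through $v\mapsto\psi^n_H(\phi_H(v))$, $\underline\pi$ acts on $A^n$ and on $Z^n\mathcal A$. For $T=A^n$ or $T=Z^n\mathcal A$, let $T\times_{\tau(\underline\pi)}\overline W\underline\pi$ be the twisted cartesian product, with simplices $(c,b)$, $\partial_0(c,b)=(\tau(\underline\pi)(b)\cdot\partial_0c,\partial_0b)$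 and all other faces and degeneracies taken componentwise, and let $p$ be its projection onto $\overline W\underline\pi$. A *lift* of $\theta(\tau)$ is a map $f$ of $O_G$-simplicial sets from $\Phi X$ to it with $pf=\theta(\tau)$. Let $A^n_\phi(X;\tau)$ be the set of lifts of $\theta(\tau)$ to $A^n\times_{\tau(\underline\pi)}\overline W\underline\pi$, an abelian group under fibrewise addition, and let $\overline\delta^n:A^n_\phi(X;\tau)\to A^{n+1}_\phi(X;\tau)$ be $(\overline\delta^nf)(x)=(\delta^nc,b)$ where $f(x)=(c,b)$. This is a cochain complex $A^*_\phi(X;\tau)$, and the lifts to $Z^n\mathcal A\times_{\tau(\underline\pi)}\overline W\underline\pi$ are $n$-cocycles of it. Two such lifts $f,f'$ are *vertically homotopic* if there is a map $F:\Phi X\times\Delta[1]\to Z^n\mathcal A\times_{\tau(\underline\pi)}\overline W\underline\pi$ of $O_G$-simplicial sets which is a homotopy from $f(G/H)$ to $f'(G/H)$ for every $H$ and satisfies $pF=\theta(\tau)\circ\mathrm{pr}_1$. **Proposition.** For every $n\ge0$, vertical homotopy is an equivalence relation on the set of lifts of $\theta(\tau)$ to $Z^n\mathcal A\times_{\tau(\underline\pi)}\overline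 W\underline\pi$, and, writing $[\Phi X,Z^n\mathcal A\times_{\tau(\underline\pi)}\overline W\underline\pi]_{\overline W\underline\pi}$ for the set of equivalence classes, there is a bijection $$H^n(A^*_\phi(X;\tau))\;\cong\;[\Phi X,\,Z^n\mathcal A\times_{\tau(\underline\pi)}\overline W\underline\pi]_{\overline W\underline\pi}$$ which sends the cohomology class of a lift $f$ to $Z^n\mathcal A\times_{\tau(\underline\pi)}\overline W\underline\pi$ to its vertical homotopy class. -/

import Mathlib

open CategoryTheory Opposite Simplicial MonoidalCategory

universe u v

/-- The category of canonical orbits `O_G`: an object is an orbit `G/H` (recorded by the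
subgroup `H`), a morphism `G/H ⟶ G/K` is a `G`-map. -/
structure OrbitCat (G : Type v) [Group G] where
  /-- the isotropy subgroup `H` of the orbit `G/H` -/
  sub : Subgroup G

namespace OrbitCat

variable {G : Type v} [Group G]

instance : Category.{v} (OrbitCat G) where
  Hom H K := (G ⧸ H.sub) →[G] (G ⧸ K.sub)
  id H := MulActionHom.id G
  comp f g := MulActionHom.comp g f

end OrbitCat

section FixedPoints

variable {G : Type v} [Group G]

/-- The action of `g` on the `q`-simplices of the `G`-simplicial set `X`. -/
def gact (X : Action SSet.{u} G) (q : SimplexCategoryᵒᵖ) (g : G) (x : X.V.obj q) : X.V.obj q :=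
  (X.ρ g).app q x

theorem gact_one (X : Action SSet.{u} G) (q : SimplexCategoryᵒᵖ) (x : X.V.obj q) :
    gact X q 1 x = x := by
  simp [gact, End.one_def]

theorem gact_mul (X : Action SSet.{u} G) (q : SimplexCategoryᵒᵖ) (g h : G) (x : X.V.obj q) :
    gact X q (g * h) x = gact X q g (gact X q h x) := by
  simp [gact, End.mul_def]

theorem gact_map (X : Action SSet.{u} G) {p q : SimplexCategoryᵒᵖ} (f : p ⟶ q) (g : G)
    (x : X.V.obj p) : X.V.map f (gact X p g x) = gact X q g (X.V.map f x) := by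
  simp [gact]

/-- The fixed point simplicial set `X^H`. -/
def fixedPoints (X : Action SSet.{u} G) (H : Subgroup G) : SSet.{u} where
  obj q := { x : X.V.obj q // ∀ h ∈ H, gact X q h x = x }
  map f := TypeCat.ofHom fun x => ⟨X.V.map f x.1, fun h hh => by rw [← gact_map, x.2 h hh]⟩
  map_id q := by
    ext x
    exact X.V.map_id_apply q x.1
  map_comp f g := by
    ext x
    exact X.V.map_comp_apply f g x.1

/-- For `x ∈ X^K`, the element `g x`, as a function of the coset `gK`. -/
def orbitPoint (X : Action SSet.{u} G) {K : Subgroup G} {q : SimplexCategoryᵒᵖ}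
    (x : (fixedPoints X K).obj q) (c : G ⧸ K) : X.V.obj q :=
  Quotient.liftOn' c (fun g => gact X q g x.1) (by
    intro a b hab
    rw [QuotientGroup.leftRel_apply] at hab
    have h := x.2 _ hab
    calc gact X q a x.1 = gact X q a (gact X q (a⁻¹ * b) x.1) := congrArg _ h.symm
      _ = gact X q b x.1 := by rw [← gact_mul, mul_inv_cancel_left])

theorem orbitPoint_mk (X : Action SSet.{u} G) {K : Subgroup G} {q : SimplexCategoryᵒᵖ}
    (x : (fixedPoints X K).obj q) (g : G) :
    orbitPoint X x (QuotientGroup.mk g : G ⧸ K) = gact X q g x.1 := rfl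

theorem orbitPoint_smul (X : Action SSet.{u} G) {K : Subgroup G} {q : SimplexCategoryᵒᵖ}
    (x : (fixedPoints X K).obj q) (h : G) (c : G ⧸ K) :
    orbitPoint X x (h • c) = gact X q h (orbitPoint X x c) := by
  induction c using QuotientGroup.induction_on with
  | H g => exact gact_mul X q h g x.1

theorem orbitPoint_map (X : Action SSet.{u} G) {K : Subgroup G} {p q : SimplexCategoryᵒᵖ}
    (f : p ⟶ q) (x : (fixedPoints X K).obj p) (c : G ⧸ K) :
    orbitPoint X ((fixedPoints X K).map f x) c = X.V.map f (orbitPoint X x c) := by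
  induction c using QuotientGroup.induction_on with
  | H g => exact (gact_map X f g x.1).symm

/-- The map `X^K → X^H` induced by a `G`-map `ĝ : G/H → G/K` with `ĝ(eH) = gK`; it sends
`x` to `g x`. -/
def fixedPointsMap (X : Action SSet.{u} G) {H K : OrbitCat G} (φ : H ⟶ K) :
    fixedPoints X K.sub ⟶ fixedPoints X H.sub where
  app q := TypeCat.ofHom fun x =>
    ⟨orbitPoint X x ((show (G ⧸ H.sub) →[G] (G ⧸ K.sub) from φ) (QuotientGroup.mk 1)), by
      intro h hh
      rw [← orbitPoint_smul, ← map_smul]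
      congr 2
      rw [MulAction.Quotient.smul_mk, QuotientGroup.eq]
      simpa using H.sub.inv_mem hh⟩
  naturality p q f := by
    ext x
    apply Subtype.ext
    exact orbitPoint_map X f x _

/-- The `O_G`-simplicial set `ΦX`, `ΦX(G/H) = X^H`, `ΦX(ĝ)(x) = g x`. -/
def Phi (X : Action SSet.{u} G) : (OrbitCat G)ᵒᵖ ⥤ SSet.{u} where
  obj H := fixedPoints X H.unop.sub
  map φ := fixedPointsMap X φ.unop
  map_id H := by
    ext q x
    apply Subtype.ext
    exact gact_one X _ _
  map_comp {H K L} φ ψ := by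
    ext q x
    apply Subtype.ext
    let a : (G ⧸ K.unop.sub) →[G] (G ⧸ H.unop.sub) := φ.unop
    let b : (G ⧸ L.unop.sub) →[G] (G ⧸ K.unop.sub) := ψ.unop
    change orbitPoint X x (a (b (QuotientGroup.mk 1))) =
      orbitPoint X ((fixedPointsMap X φ.unop).app q x) (b (QuotientGroup.mk 1))
    generalize b (QuotientGroup.mk 1) = c
    induction c using QuotientGroup.induction_on with
    | H g =>
      rw [orbitPoint_mk]
      change _ = gact X q g (orbitPoint X x (a (QuotientGroup.mk 1)))
      rw [← orbitPoint_smul, ← map_smul]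
      congr 2
      simp [MulAction.Quotient.smul_mk]

end FixedPoints

section WBar

/-- The (discrete-group) `W̄`-construction. A `q`-simplex `[x₁, …, x_q]` of `W̄P` is the chain of
arrows `x₁, …, x_q` of the one-object category with arrows `P`, in which the composite of the
arrow `x` followed by the arrow `y` is `y * x`. See `WBar.coord` and the lemmas after it. -/
abbrev WBar (P : Type u) [Group P] : SSet.{u} := nerve (SingleObj P)

namespace WBar

variable {P Q : Type u} [Group P] [Group Q]

/-- The element `x_j ⋯ x_{i+1}` of `P` carried by the edge from vertex `i` to vertex `j` of the
simplex `[x₁, …, x_q]` of `W̄P`. -/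
def edge {q : SimplexCategoryᵒᵖ} (σ : (WBar P).obj q) {i j : Fin (q.unop.len + 1)} (h : i ≤ j) : P :=
  CategoryTheory.Functor.map (show Fin (q.unop.len + 1) ⥤ SingleObj P from σ) (homOfLE h)

/-- The coordinate `x_{i+1}` of `[x₁, …, x_q]`, for `i : Fin q`. -/
def coord {q : ℕ} (σ : (WBar P) _⦋q⦌) (i : Fin q) : P :=
  edge (q := op ⦋q⦌) σ (i := i.castSucc) (j := i.succ) (Fin.castSucc_le_succ i)

theorem edge_congr {q : SimplexCategoryᵒᵖ} (σ : (WBar P).obj q) {i j i' j' : Fin (q.unop.len + 1)}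
    (hi : i = i') (hj : j = j') (h : i ≤ j) (h' : i' ≤ j') : edge σ h = edge σ h' := by
  subst hi hj; rfl

theorem edge_refl {q : SimplexCategoryᵒᵖ} (σ : (WBar P).obj q) (i : Fin (q.unop.len + 1)) :
    edge σ (le_refl i) = 1 :=
  CategoryTheory.Functor.map_id (show Fin (q.unop.len + 1) ⥤ SingleObj P from σ) i

theorem edge_trans {q : SimplexCategoryᵒᵖ} (σ : (WBar P).obj q) {i j k : Fin (q.unop.len + 1)}
    (h : i ≤ j) (h' : j ≤ k) : edge σ (h.trans h') = edge σ h' * edge σ h :=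
  CategoryTheory.Functor.map_comp (show Fin (q.unop.len + 1) ⥤ SingleObj P from σ) (homOfLE h) (homOfLE h')

theorem edge_map {p q : SimplexCategoryᵒᵖ} (f : p ⟶ q) (σ : (WBar P).obj p)
    {i j : Fin (q.unop.len + 1)} (h : i ≤ j) :
    edge ((WBar P).map f σ) h = edge σ (f.unop.toOrderHom.monotone h) := rfl

theorem ext {q : SimplexCategoryᵒᵖ} {σ σ' : (WBar P).obj q}
    (h : ∀ (i j : Fin (q.unop.len + 1)) (hij : i ≤ j), edge σ hij = edge σ' hij) : σ = σ' := by
  refine CategoryTheory.Functor.hext (C := Fin (q.unop.len + 1)) (D := SingleObj P) (F := σ) (G := σ')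
    (fun i => Subsingleton.elim (α := Unit) _ _) (fun i j f => ?_)
  exact heq_of_eq (h i j (leOfHom f))

/-- A simplex of `W̄P` is determined by its coordinates. -/
theorem ext_coord {q : ℕ} {σ σ' : (WBar P) _⦋q⦌} (h : ∀ i, coord σ i = coord σ' i) : σ = σ' := by
  have key : ∀ (n : ℕ) (i j : Fin (q + 1)) (hij : i ≤ j), j.val = i.val + n →
      edge (q := op ⦋q⦌) σ (i := i) (j := j) hij = edge (q := op ⦋q⦌) σ' (i := i) (j := j) hij := by
    intro n
    induction n with
    | zero =>
      intro i j hij hn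
      obtain rfl : i = j := Fin.ext (by simpa using hn.symm)
      rw [edge_refl, edge_refl]
    | succ n ih =>
      intro i j hij hn
      obtain ⟨k, hk⟩ : ∃ k : Fin q, k.val = i.val + n :=
        ⟨⟨i.val + n, by have := j.isLt; omega⟩, rfl⟩
      have hik : i ≤ k.castSucc := by simp [Fin.le_def, hk]
      obtain rfl : k.succ = j := by apply Fin.ext; simp; omega
      have h1 := edge_trans (q := op ⦋q⦌) σ hik (Fin.castSucc_le_succ k)
      have h2 := edge_trans (q := op ⦋q⦌) σ' hik (Fin.castSucc_le_succ k)
      refine h1.trans (Eq.trans ?_ h2.symm)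
      rw [ih i k.castSucc hik (by simp [hk])]
      exact congrArg (· * _) (h k)
  exact ext fun i j hij => key (j.val - i.val) i j hij (by have := Fin.le_def.1 hij; omega)

/-- Every tuple `[x₁, …, x_q]` is a simplex of `W̄P`. -/
noncomputable def mk {q : ℕ} (x : Fin q → P) : (WBar P) _⦋q⦌ :=
  ComposableArrows.mkOfObjOfMapSucc (C := SingleObj P) (fun _ => SingleObj.star P) x

theorem coord_mk {q : ℕ} (x : Fin q → P) (i : Fin q) : coord (mk x) i = x i :=
  ComposableArrows.mkOfObjOfMapSucc_map_succ (C := SingleObj P) (fun _ => SingleObj.star P) x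
    i.val i.isLt

/-- `∂₀[x₁, …, x_{q+1}] = [x₂, …, x_{q+1}]`. -/
theorem coord_δ_zero {q : ℕ} (σ : (WBar P) _⦋q + 1⦌) (i : Fin q) :
    coord ((WBar P).δ 0 σ) i = coord σ i.succ := rfl

/-- `∂ᵢ[x₁, …, x_{q+2}] = [x₁, …, x_{i+1} xᵢ, …, x_{q+2}]` for `0 < i < q + 2`: the coordinate
that is changed. -/
theorem coord_δ_self {q : ℕ} (σ : (WBar P) _⦋q + 2⦌) (i : Fin (q + 1)) :
    coord ((WBar P).δ i.succ.castSucc σ) i = coord σ i.succ * coord σ i.castSucc := by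
  have e := edge_trans (q := op ⦋q + 2⦌) σ (Fin.castSucc_le_succ i.castSucc)
    (Fin.castSucc_le_succ i.succ)
  refine Eq.trans ?_ e
  refine edge_congr (q := op ⦋q + 2⦌) σ ?_ ?_ _ _
  · exact Fin.succAbove_of_castSucc_lt _ _ (by simp [Fin.lt_def])
  · exact Fin.succAbove_of_le_castSucc _ _ (by simp)

/-- The homomorphism-functoriality `W̄P → W̄Q`. -/
def map (f : P →* Q) : WBar P ⟶ WBar Q := nerveMap (SingleObj.mapHom P Q f)

theorem edge_mapHom (f : P →* Q) {q : SimplexCategoryᵒᵖ} (σ : (WBar P).obj q)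
    {i j : Fin (q.unop.len + 1)} (h : i ≤ j) :
    edge ((map f).app q σ) h = f (edge σ h) := rfl

end WBar

end WBar

section Twisting

set_option linter.unusedSimpArgs false

/-- Twisting functions `τ_q : B_q → Γ_{q-1}`, `q ≥ 1` (the index is shifted by one). -/
structure IsTwistingFunction (B : SSet.{u}) (Γ : SimplicialObject GrpCat.{u})
    (τ : ∀ q : ℕ, B _⦋q + 1⦌ → Γ _⦋q⦌) : Prop where
  δ_zero : ∀ (q : ℕ) (b : B _⦋q + 2⦌),
    Γ.δ 0 (τ (q + 1) b) = (τ q (B.δ 0 b))⁻¹ * τ q (B.δ 1 b)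
  δ_succ : ∀ (q : ℕ) (b : B _⦋q + 2⦌) (i : Fin (q + 1)),
    Γ.δ i.succ (τ (q + 1) b) = τ q (B.δ i.succ.succ b)
  σ_succ : ∀ (q : ℕ) (b : B _⦋q + 1⦌) (i : Fin (q + 1)),
    Γ.σ i (τ q b) = τ (q + 1) (B.σ i.succ b)
  σ_zero : ∀ (q : ℕ) (b : B _⦋q⦌), τ q (B.σ 0 b) = 1

/-- The group `P` as a simplicial group with all faces and degeneracies identities. -/
abbrev constGroup (P : GrpCat.{u}) : SimplicialObject GrpCat.{u} :=
  (SimplicialObject.const GrpCat.{u}).obj P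

/-- `τ(P)([x₁, …, x_q]) = x₁` is a twisting function `W̄P → P`. -/
theorem isTwistingFunction_coord (P : GrpCat.{u}) :
    IsTwistingFunction (WBar P) (constGroup P) (fun _ σ => WBar.coord σ 0) where
  δ_zero q b := by
    have h := WBar.coord_δ_self b 0
    have h0 := WBar.coord_δ_zero b 0
    exact eq_inv_mul_of_mul_eq h.symm
  δ_succ q b i := rfl
  σ_succ q b i := rfl
  σ_zero q b := WBar.edge_refl (q := op ⦋q⦌) b 0

/-- For `i < q`, the face operator `∂₀^i` (restriction to the vertices `i, …, q`). -/
def lastFace (q i m : ℕ) (h : i + (m + 1) = q) : ⦋m + 1⦌ ⟶ ⦋q⦌ :=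
  SimplexCategory.mkHom
    { toFun := fun k => ⟨i + k.val, by have := k.isLt; omega⟩
      monotone' := fun a b hab => Nat.add_le_add_left (Fin.le_def.1 hab) i }

variable {B : SSet.{u}} {P : GrpCat.{u}} (τ : ∀ q : ℕ, B _⦋q + 1⦌ → P)

/-- `θ(τ)(x) = [τ(x), τ(∂₀x), …, τ(∂₀^{q-1}x)]` on a `q`-simplex `x`. -/
noncomputable def thetaSimplex {q : ℕ} (x : B _⦋q⦌) : (WBar P) _⦋q⦌ :=
  WBar.mk fun i : Fin q =>
    τ (q - 1 - i.val) (B.map (lastFace q i.val (q - 1 - i.val) (by have := i.isLt; omega)).op x)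

theorem coord_thetaSimplex {q : ℕ} (x : B _⦋q⦌) (i : Fin q) (m : ℕ) (h : i.val + (m + 1) = q) :
    WBar.coord (thetaSimplex τ x) i = τ m (B.map (lastFace q i.val m h).op x) := by
  obtain rfl : m = q - 1 - i.val := by omega
  exact WBar.coord_mk _ _

theorem coord_thetaSimplex_zero {q : ℕ} (x : B _⦋q + 1⦌) :
    WBar.coord (thetaSimplex τ x) 0 = τ q x := by
  rw [coord_thetaSimplex τ x 0 q (by simp)]
  have : lastFace (q + 1) (0 : Fin (q + 1)).val q (by simp) = 𝟙 _ := by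
    ext k
    simp [lastFace]
  rw [this]
  exact congrArg _ (B.map_id_apply _ x)

variable {τ}

theorem map_op_congr {B : SSet.{u}} {p q r r' : SimplexCategory} {f : p ⟶ r} {g : r ⟶ q}
    {f' : p ⟶ r'} {g' : r' ⟶ q} (h : f ≫ g = f' ≫ g') (x : B.obj (op q)) :
    B.map f.op (B.map g.op x) = B.map f'.op (B.map g'.op x) := by
  refine (B.map_comp_apply g.op f.op x).symm.trans (Eq.trans ?_ (B.map_comp_apply g'.op f'.op x))
  rw [← op_comp, ← op_comp, h]

theorem map_op_congr' {B : SSet.{u}} {p q r : SimplexCategory} {f : p ⟶ r} {g : r ⟶ q}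
    {k : p ⟶ q} (h : f ≫ g = k) (x : B.obj (op q)) :
    B.map f.op (B.map g.op x) = B.map k.op x := by
  refine (B.map_comp_apply g.op f.op x).symm.trans ?_
  rw [← op_comp, h]

theorem δ_val {n : ℕ} (i : Fin (n + 2)) (k : Fin (n + 1)) :
    ((SimplexCategory.δ i).toOrderHom k).val = if k.val < i.val then k.val else k.val + 1 := by
  change (i.succAbove k).val = _
  simp only [Fin.succAbove, Fin.lt_def]
  split_ifs <;> simp_all

theorem σ_val {n : ℕ} (i : Fin (n + 1)) (k : Fin (n + 2)) :
    ((SimplexCategory.σ i).toOrderHom k).val = if i.val < k.val then k.val - 1 else k.val := by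
  change (i.predAbove k).val = _
  simp only [Fin.predAbove, Fin.lt_def, Fin.val_castSucc]
  split_ifs <;> simp

theorem lastFace_val {q i m : ℕ} (h : i + (m + 1) = q) (k : Fin (m + 2)) :
    ((lastFace q i m h).toOrderHom k).val = i + k.val := rfl

theorem simplexHom_ext {a b : ℕ} {f g : (⦋a⦌ : SimplexCategory) ⟶ ⦋b⦌}
    (h : ∀ k : Fin (a + 1), (f.toOrderHom k).val = (g.toOrderHom k).val) : f = g := by
  ext k
  exact h k

theorem toOrderHom_comp_val {a b c : ℕ} (f : (⦋a⦌ : SimplexCategory) ⟶ ⦋b⦌)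
    (g : (⦋b⦌ : SimplexCategory) ⟶ ⦋c⦌) (k : Fin (a + 1)) :
    ((f ≫ g).toOrderHom k).val = (g.toOrderHom (f.toOrderHom k)).val := rfl

theorem thetaSimplex_δ (hτ : IsTwistingFunction B (constGroup P) τ) {q : ℕ} (x : B _⦋q + 1⦌)
    (i : Fin (q + 2)) :
    (WBar P).δ i (thetaSimplex τ x) = thetaSimplex τ (B.δ i x) := by
  refine WBar.ext_coord fun k => ?_
  obtain ⟨m, hm⟩ : ∃ m, k.val + (m + 1) = q := ⟨q - 1 - k.val, by have := k.isLt; omega⟩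
  rw [coord_thetaSimplex τ _ k m hm]
  have hi := i.isLt
  rcases lt_trichotomy i.val (k.val + 1) with h | h | h
  · have e : WBar.coord ((WBar P).δ i (thetaSimplex τ x)) k =
        WBar.coord (thetaSimplex τ x) k.succ :=
      WBar.edge_congr (q := op ⦋q + 1⦌) (thetaSimplex τ x)
        (Fin.ext ((δ_val i k.castSucc).trans (by simp only [Fin.val_succ, Fin.val_castSucc, Fin.val_zero, Fin.val_one]; split_ifs <;> omega)))
        (Fin.ext ((δ_val i k.succ).trans (by simp only [Fin.val_succ, Fin.val_castSucc, Fin.val_zero, Fin.val_one]; split_ifs <;> omega))) _ _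
    rw [e, coord_thetaSimplex τ x k.succ m (by simp only [Fin.val_succ, Fin.val_castSucc, Fin.val_zero, Fin.val_one]; omega)]
    refine congrArg (τ m) (map_op_congr' (simplexHom_ext fun l => ?_) x).symm
    rw [toOrderHom_comp_val, δ_val, lastFace_val, lastFace_val]
    try simp only [Fin.val_succ, Fin.val_castSucc, Fin.val_zero, Fin.val_one]
    split_ifs <;> omega
  · have e : WBar.coord ((WBar P).δ i (thetaSimplex τ x)) k =
        WBar.coord (thetaSimplex τ x) k.succ * WBar.coord (thetaSimplex τ x) k.castSucc :=
      Eq.trans (WBar.edge_congr (q := op ⦋q + 1⦌) (thetaSimplex τ x)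
        (Fin.ext ((δ_val i k.castSucc).trans (by simp only [Fin.val_succ, Fin.val_castSucc, Fin.val_zero, Fin.val_one]; split_ifs <;> omega)))
        (Fin.ext ((δ_val i k.succ).trans (by simp only [Fin.val_succ, Fin.val_castSucc, Fin.val_zero, Fin.val_one]; split_ifs <;> omega))) _ _)
        (WBar.edge_trans (q := op ⦋q + 1⦌) (thetaSimplex τ x)
          (Fin.castSucc_le_succ k.castSucc) (Fin.castSucc_le_succ k.succ))
    rw [e, coord_thetaSimplex τ x k.succ m (by simp only [Fin.val_succ, Fin.val_castSucc, Fin.val_zero, Fin.val_one]; omega),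
      coord_thetaSimplex τ x k.castSucc (m + 1) (by simp only [Fin.val_succ, Fin.val_castSucc, Fin.val_zero, Fin.val_one]; omega)]
    have t := hτ.δ_zero m (B.map (lastFace (q + 1) k.castSucc.val (m + 1) (by simp only [Fin.val_succ, Fin.val_castSucc, Fin.val_zero, Fin.val_one]; omega)).op x)
    refine Eq.trans ?_ (Eq.trans (eq_inv_mul_iff_mul_eq.1 t) ?_)
    · refine congrArg (fun z => τ m z * _) (map_op_congr' (simplexHom_ext fun l => ?_) x).symm
      rw [toOrderHom_comp_val, lastFace_val, δ_val, lastFace_val]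
      try simp only [Fin.val_succ, Fin.val_castSucc, Fin.val_zero, Fin.val_one]
      grind
    · refine congrArg (τ m) (map_op_congr (simplexHom_ext fun l => ?_) x)
      rw [toOrderHom_comp_val, toOrderHom_comp_val, lastFace_val, δ_val, δ_val, lastFace_val]
      try simp only [Fin.val_succ, Fin.val_castSucc, Fin.val_zero, Fin.val_one]
      grind
  · have e : WBar.coord ((WBar P).δ i (thetaSimplex τ x)) k =
        WBar.coord (thetaSimplex τ x) k.castSucc :=
      WBar.edge_congr (q := op ⦋q + 1⦌) (thetaSimplex τ x)
        (Fin.ext ((δ_val i k.castSucc).trans (by simp only [Fin.val_succ, Fin.val_castSucc, Fin.val_zero, Fin.val_one]; split_ifs <;> omega)))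
        (Fin.ext ((δ_val i k.succ).trans (by simp only [Fin.val_succ, Fin.val_castSucc, Fin.val_zero, Fin.val_one]; split_ifs <;> omega))) _ _
    rw [e, coord_thetaSimplex τ x k.castSucc (m + 1) (by simp only [Fin.val_succ, Fin.val_castSucc, Fin.val_zero, Fin.val_one]; omega)]
    have t := hτ.δ_succ m (B.map (lastFace (q + 1) k.castSucc.val (m + 1) (by simp only [Fin.val_succ, Fin.val_castSucc, Fin.val_zero, Fin.val_one]; omega)).op x)
      ⟨i.val - k.val - 2, by omega⟩
    refine Eq.trans t ?_
    refine congrArg (τ m) (map_op_congr (simplexHom_ext fun l => ?_) x)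
    rw [toOrderHom_comp_val, toOrderHom_comp_val, lastFace_val, δ_val, δ_val, lastFace_val]
    try simp only [Fin.val_succ, Fin.val_castSucc, Fin.val_zero, Fin.val_one]
    split_ifs <;> omega

theorem thetaSimplex_σ (hτ : IsTwistingFunction B (constGroup P) τ) {q : ℕ} (x : B _⦋q⦌)
    (i : Fin (q + 1)) :
    (WBar P).σ i (thetaSimplex τ x) = thetaSimplex τ (B.σ i x) := by
  refine WBar.ext_coord fun k => ?_
  obtain ⟨m, hm⟩ : ∃ m, k.val + (m + 1) = q + 1 := ⟨q - k.val, by have := k.isLt; omega⟩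
  rw [coord_thetaSimplex τ _ k m hm]
  have hi := i.isLt
  have hk := k.isLt
  rcases lt_trichotomy i.val k.val with h | h | h
  · have e : WBar.coord ((WBar P).σ i (thetaSimplex τ x)) k =
        WBar.coord (thetaSimplex τ x) ⟨k.val - 1, by omega⟩ :=
      WBar.edge_congr (q := op ⦋q⦌) (thetaSimplex τ x)
        (Fin.ext ((σ_val i k.castSucc).trans (by simp only [Fin.val_succ, Fin.val_castSucc, Fin.val_zero, Fin.val_one]; split_ifs <;> omega)))
        (Fin.ext ((σ_val i k.succ).trans (by simp only [Fin.val_succ, Fin.val_castSucc, Fin.val_zero, Fin.val_one]; split_ifs <;> omega))) _ _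
    rw [e, coord_thetaSimplex τ x _ m (by simp only [Fin.val_succ, Fin.val_castSucc, Fin.val_zero, Fin.val_one]; omega)]
    refine congrArg (τ m) (map_op_congr' (simplexHom_ext fun l => ?_) x).symm
    rw [toOrderHom_comp_val, σ_val, lastFace_val, lastFace_val]
    try simp only [Fin.val_succ, Fin.val_castSucc, Fin.val_zero, Fin.val_one]
    split_ifs <;> omega
  · have e : WBar.coord ((WBar P).σ i (thetaSimplex τ x)) k = 1 :=
      Eq.trans (WBar.edge_congr (q := op ⦋q⦌) (thetaSimplex τ x)
        (Fin.ext ((σ_val i k.castSucc).trans (by simp only [Fin.val_succ, Fin.val_castSucc, Fin.val_zero, Fin.val_one]; split_ifs <;> omega)))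
        (Fin.ext ((σ_val i k.succ).trans (by simp only [Fin.val_succ, Fin.val_castSucc, Fin.val_zero, Fin.val_one]; split_ifs <;> omega))) _ (le_refl i))
        (WBar.edge_refl (q := op ⦋q⦌) _ _)
    rw [e]
    let f : (⦋m⦌ : SimplexCategory) ⟶ ⦋q⦌ := SimplexCategory.mkHom
      { toFun := fun l => ⟨k.val + l.val, by have := l.isLt; omega⟩
        monotone' := fun a b hab => Nat.add_le_add_left (Fin.le_def.1 hab) k.val }
    refine (hτ.σ_zero m (B.map f.op x)).symm.trans ?_
    refine congrArg (τ m) (map_op_congr (simplexHom_ext fun l => ?_) x)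
    have hf : ∀ l, (f.toOrderHom l).val = k.val + l.val := fun l => rfl
    rw [toOrderHom_comp_val, toOrderHom_comp_val, σ_val, hf, σ_val, lastFace_val]
    try simp only [Fin.val_succ, Fin.val_castSucc, Fin.val_zero, Fin.val_one]
    grind
  · obtain ⟨m, rfl⟩ : ∃ m', m = m' + 1 := ⟨m - 1, by omega⟩
    have e : WBar.coord ((WBar P).σ i (thetaSimplex τ x)) k =
        WBar.coord (thetaSimplex τ x) ⟨k.val, by omega⟩ :=
      WBar.edge_congr (q := op ⦋q⦌) (thetaSimplex τ x)
        (Fin.ext ((σ_val i k.castSucc).trans (by simp only [Fin.val_succ, Fin.val_castSucc, Fin.val_zero, Fin.val_one]; split_ifs <;> omega)))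
        (Fin.ext ((σ_val i k.succ).trans (by simp only [Fin.val_succ, Fin.val_castSucc, Fin.val_zero, Fin.val_one]; split_ifs <;> omega))) _ _
    rw [e, coord_thetaSimplex τ x _ m (by simp only [Fin.val_succ, Fin.val_castSucc, Fin.val_zero, Fin.val_one]; omega)]
    refine (hτ.σ_succ m _ ⟨i.val - k.val - 1, by omega⟩).trans ?_
    refine congrArg (τ (m + 1)) (map_op_congr (simplexHom_ext fun l => ?_) x)
    rw [toOrderHom_comp_val, toOrderHom_comp_val, lastFace_val, σ_val, σ_val, lastFace_val]
    try simp only [Fin.val_succ, Fin.val_castSucc, Fin.val_zero, Fin.val_one]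
    split_ifs <;> omega

theorem thetaSimplex_naturality (hτ : IsTwistingFunction B (constGroup P) τ)
    {p q : SimplexCategory} (f : p ⟶ q) (x : B.obj (op q)) :
    (WBar P).map f.op (thetaSimplex (q := q.len) τ x) =
      thetaSimplex (q := p.len) τ (B.map f.op x) := by
  let W : MorphismProperty SimplexCategory := fun p q f => ∀ x : B.obj (op q),
    (WBar P).map f.op (thetaSimplex (q := q.len) τ x) =
      thetaSimplex (q := p.len) τ (B.map f.op x)
  have hW : W.IsMultiplicative :=
    { id_mem := fun p x => by
        have h1 := (WBar P).map_id_apply _ (thetaSimplex (q := p.len) τ x)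
        have h2 := B.map_id_apply _ x
        exact h1.trans (congrArg _ h2.symm)
      comp_mem := fun f g hf hg x => by
        have h1 := (WBar P).map_comp_apply g.op f.op (thetaSimplex τ x)
        have h2 := B.map_comp_apply g.op f.op x
        refine h1.trans ?_
        rw [hg x, hf _]
        exact congrArg _ h2.symm }
  have htop : W = ⊤ := SimplexCategory.morphismProperty_eq_top W
    (fun {n} i x => thetaSimplex_δ hτ x i) (fun {n} i x => thetaSimplex_σ hτ x i)
  have : W f := by rw [htop]; trivial
  exact this x

/-- The simplicial map `θ(τ) : B → W̄P` of a twisting function `τ : B → P`. -/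
noncomputable def thetaMap (hτ : IsTwistingFunction B (constGroup P) τ) : B ⟶ WBar P where
  app q := TypeCat.ofHom fun x => thetaSimplex (q := q.unop.len) τ x
  naturality p q f := by
    ext x
    exact (thetaSimplex_naturality hτ f.unop x).symm

end Twisting

section Actions

variable {G : Type v} [Group G]

/-- An action of the `O_G`-group `π` on a contravariant functor `T : O_G → C`. -/
structure OAction {C : Type*} [Category* C] (π : (OrbitCat G)ᵒᵖ ⥤ GrpCat.{u})
    (T : (OrbitCat G)ᵒᵖ ⥤ C) where
  /-- the homomorphisms `π(G/H) → Aut (T(G/H))` -/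
  ρ : ∀ H : (OrbitCat G)ᵒᵖ, π.obj H →* Aut (T.obj H)
  /-- `ρ_H(π(ĝ)v) ∘ T(ĝ) = T(ĝ) ∘ ρ_K(v)` -/
  comm : ∀ {K H : (OrbitCat G)ᵒᵖ} (g : K ⟶ H) (v : π.obj K),
    T.map g ≫ (ρ H (π.map g v)).hom = (ρ K v).hom ≫ T.map g

/-- The action induced on `F ∘ T` by a functor `F`. -/
def OAction.comp {C D : Type*} [Category* C] [Category* D] {π : (OrbitCat G)ᵒᵖ ⥤ GrpCat.{u}}
    {T : (OrbitCat G)ᵒᵖ ⥤ C} (a : OAction π T) (F : C ⥤ D) : OAction π (T ⋙ F) where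
  ρ H := (F.mapAut (T.obj H)).comp (a.ρ H)
  comm g v := by
    change F.map _ ≫ F.map _ = F.map _ ≫ F.map _
    rw [← F.map_comp, ← F.map_comp, a.comm]

/-- The underlying simplicial set of a simplicial abelian group. -/
abbrev underlying : SimplicialObject AddCommGrpCat.{u} ⥤ SSet.{u} :=
  (SimplicialObject.whiskering AddCommGrpCat.{u} (Type u)).obj (forget AddCommGrpCat.{u})

end Actions

section TCP

theorem typeHom_ext {X Y : Type u} {f g : X ⟶ Y} (h : ∀ x, f x = g x) : f = g :=
  ConcreteCategory.hom_ext _ _ h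

theorem typeHom_prod_ext {X A B : Type u} {f g : X ⟶ A × B} (h₁ : ∀ x, (f x).1 = (g x).1)
    (h₂ : ∀ x, (f x).2 = (g x).2) : f = g :=
  typeHom_ext fun x => Prod.ext (h₁ x) (h₂ x)

variable {P : Type u} [Group P] {F : SSet.{u}}

theorem aut_mul_app (ρ : P →* Aut F) (x y : P) (q : SimplexCategoryᵒᵖ) (c : F.obj q) :
    (ρ (x * y)).hom.app q c = (ρ x).hom.app q ((ρ y).hom.app q c) := by
  rw [map_mul]; rfl

theorem aut_one_app (ρ : P →* Aut F) (q : SimplexCategoryᵒᵖ) (c : F.obj q) :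
    (ρ 1).hom.app q c = c := by
  rw [map_one]; rfl

theorem aut_naturality (ρ : P →* Aut F) (x : P) {p q : SimplexCategoryᵒᵖ} (f : p ⟶ q)
    (c : F.obj p) : F.map f ((ρ x).hom.app p c) = (ρ x).hom.app q (F.map f c) :=
  ((ρ x).hom.naturality_apply f c).symm

/-- The twisted cartesian product `F ×_{τ(P)} W̄P`. Its `q`-simplices are the pairs `(c, b)`, and a
simplicial operator `f` sends `(c, b)` to `(x • f^*c, f^*b)` where `x` is the element of `P`
carried by the edge of `b` from vertex `0` to vertex `f(0)`. On faces and degeneracies this is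
the usual definition, see `twistedProduct_δ_zero`, `twistedProduct_δ_succ`, `twistedProduct_σ`. -/
def twistedProduct (ρ : P →* Aut F) : SSet.{u} where
  obj q := F.obj q × (WBar P).obj q
  map {p q} f := TypeCat.ofHom fun z =>
    ((ρ (WBar.edge z.2 (Fin.zero_le (f.unop.toOrderHom 0)))).hom.app q (F.map f z.1),
      (WBar P).map f z.2)
  map_id q := by
    refine typeHom_prod_ext (fun z => ?_) fun z => (WBar P).map_id_apply q z.2
    change (ρ (WBar.edge z.2 (le_refl 0))).hom.app q (F.map (𝟙 q) z.1) = z.1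
    rw [WBar.edge_refl, aut_one_app]
    exact F.map_id_apply q z.1
  map_comp {p q r} f g := by
    refine typeHom_prod_ext (fun z => ?_) fun z => (WBar P).map_comp_apply f g z.2
    change (ρ _).hom.app r (F.map (f ≫ g) z.1) =
      (ρ _).hom.app r (F.map g ((ρ _).hom.app q (F.map f z.1)))
    rw [aut_naturality, ← aut_mul_app]
    refine congrArg₂ (fun x c => (ρ x).hom.app r c) ?_ (F.map_comp_apply f g z.1)
    exact WBar.edge_trans z.2 (Fin.zero_le _)
      (f.unop.toOrderHom.monotone (Fin.zero_le (g.unop.toOrderHom 0)))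

theorem twistedProduct_δ_zero (ρ : P →* Aut F) {q : ℕ} (c : F _⦋q + 1⦌) (b : (WBar P) _⦋q + 1⦌) :
    (twistedProduct ρ).δ 0 (show (twistedProduct ρ) _⦋q + 1⦌ from (c, b)) =
      ((ρ (WBar.coord b 0)).hom.app (op ⦋q⦌) (F.δ 0 c), (WBar P).δ 0 b) := rfl

theorem twistedProduct_δ_succ (ρ : P →* Aut F) {q : ℕ} (i : Fin (q + 1)) (c : F _⦋q + 1⦌)
    (b : (WBar P) _⦋q + 1⦌) :
    (twistedProduct ρ).δ i.succ (show (twistedProduct ρ) _⦋q + 1⦌ from (c, b)) =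
      (F.δ i.succ c, (WBar P).δ i.succ b) := by
  refine Prod.ext ?_ rfl
  exact (congrArg (fun x => (ρ x).hom.app (op ⦋q⦌) (F.δ i.succ c))
    (WBar.edge_refl (q := op ⦋q + 1⦌) b 0)).trans (aut_one_app ρ _ _)

theorem twistedProduct_σ (ρ : P →* Aut F) {q : ℕ} (i : Fin (q + 1)) (c : F _⦋q⦌)
    (b : (WBar P) _⦋q⦌) :
    (twistedProduct ρ).σ i (show (twistedProduct ρ) _⦋q⦌ from (c, b)) =
      (F.σ i c, (WBar P).σ i b) := by
  refine Prod.ext ?_ rfl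
  exact (congrArg (fun x => (ρ x).hom.app (op ⦋q + 1⦌) (F.σ i c))
    (WBar.edge_refl (q := op ⦋q⦌) b 0)).trans (aut_one_app ρ _ _)

end TCP

section OTCP

variable {G : Type v} [Group G] {π : (OrbitCat G)ᵒᵖ ⥤ GrpCat.{u}}

/-- The `O_G`-simplicial set `W̄π`. -/
def OWBar (π : (OrbitCat G)ᵒᵖ ⥤ GrpCat.{u}) : (OrbitCat G)ᵒᵖ ⥤ SSet.{u} where
  obj H := WBar (π.obj H)
  map g := WBar.map (π.map g).hom
  map_id H := by
    ext q b
    exact WBar.ext fun i j h => π.map_id_apply H (WBar.edge b h)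
  map_comp g g' := by
    ext q b
    exact WBar.ext fun i j h => π.map_comp_apply g g' (WBar.edge b h)

theorem oaction_comm_app {T : (OrbitCat G)ᵒᵖ ⥤ SSet.{u}} (a : OAction π T) {K H : (OrbitCat G)ᵒᵖ}
    (g : K ⟶ H) (v : π.obj K) (q : SimplexCategoryᵒᵖ) (c : (T.obj K).obj q) :
    (T.map g).app q ((a.ρ K v).hom.app q c) =
      (a.ρ H (π.map g v)).hom.app q ((T.map g).app q c) := by
  have h := congrArg (fun (m : T.obj K ⟶ T.obj H) => m.app q c) (a.comm g v)
  exact h.symm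

/-- The `O_G`-twisted cartesian product `T ×_{τ(π)} W̄π`. -/
def OTCP {T : (OrbitCat G)ᵒᵖ ⥤ SSet.{u}} (a : OAction π T) : (OrbitCat G)ᵒᵖ ⥤ SSet.{u} where
  obj H := twistedProduct (a.ρ H)
  map {K H} g :=
    { app := fun q => TypeCat.ofHom fun z => ((T.map g).app q z.1, ((OWBar π).map g).app q z.2)
      naturality := fun p q f => by
        refine typeHom_prod_ext (fun z => ?_) fun z => ?_
        swap
        · let w : (T.obj K).obj p × (WBar (π.obj K)).obj p := z
          exact ((OWBar π).map g).naturality_apply f w.2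
        refine (oaction_comm_app a g _ q _).trans ?_
        exact congrArg _ ((T.map g).naturality_apply f z.1) }
  map_id H := by
    refine SSet.hom_ext fun q => typeHom_prod_ext (fun z => ?_) fun z => ?_
    · exact congrArg (fun (m : T.obj H ⟶ T.obj H) => m.app q z.1) (T.map_id H)
    · exact congrArg (fun (m : (OWBar π).obj H ⟶ (OWBar π).obj H) => m.app q z.2)
        ((OWBar π).map_id H)
  map_comp {K H L} g g' := by
    refine SSet.hom_ext fun q => typeHom_prod_ext (fun z => ?_) fun z => ?_
    · exact congrArg (fun (m : T.obj K ⟶ T.obj L) => m.app q z.1) (T.map_comp g g')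
    · exact congrArg (fun (m : (OWBar π).obj K ⟶ (OWBar π).obj L) => m.app q z.2)
        ((OWBar π).map_comp g g')

/-- The projection `p : T ×_{τ(π)} W̄π → W̄π`. -/
def OTCP.proj {T : (OrbitCat G)ᵒᵖ ⥤ SSet.{u}} (a : OAction π T) : OTCP a ⟶ OWBar π where
  app _ :=
    { app := fun _ => TypeCat.ofHom fun z => z.2
      naturality := fun _ _ _ => rfl }
  naturality _ _ _ := rfl

/-- The map `(c, b) ↦ (m c, b)` over `W̄π` induced by an equivariant map `m`. -/
def OTCP.mapFibre {T T' : (OrbitCat G)ᵒᵖ ⥤ SSet.{u}} (a : OAction π T) (a' : OAction π T')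
    (m : T ⟶ T') (hm : ∀ H (v : π.obj H), (a.ρ H v).hom ≫ m.app H = m.app H ≫ (a'.ρ H v).hom) :
    OTCP a ⟶ OTCP a' where
  app H :=
    { app := fun q => TypeCat.ofHom fun z => ((m.app H).app q z.1, z.2)
      naturality := fun p q f => by
        refine typeHom_prod_ext (fun z => ?_) fun z => rfl
        let v : π.obj H := WBar.edge z.2 (Fin.zero_le (f.unop.toOrderHom 0))
        have h := congrArg (fun (n : T.obj H ⟶ T'.obj H) => n.app q ((T.obj H).map f z.1)) (hm H v)
        refine Eq.trans h ?_
        exact congrArg ((a'.ρ H v).hom.app q) ((m.app H).naturality_apply f z.1) }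
  naturality K H g := by
    refine SSet.hom_ext fun q => typeHom_prod_ext (fun z => ?_) fun z => rfl
    exact congrArg (fun (n : T.obj K ⟶ T'.obj H) => n.app q z.1) (m.naturality g)

end OTCP

section Cartan

/-- The simplicial abelian group `Ker d` of a map of simplicial abelian groups. -/
def kerS {A B : SimplicialObject AddCommGrpCat.{u}} (d : A ⟶ B) :
    SimplicialObject AddCommGrpCat.{u} where
  obj q := AddCommGrpCat.of (d.app q).hom.ker
  map {p q} f := AddCommGrpCat.ofHom
    (((A.map f).hom.comp (d.app p).hom.ker.subtype).codRestrict (d.app q).hom.ker fun x => by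
      change d.app q (A.map f x.1) = 0
      rw [d.naturality_apply f x.1]
      exact (congrArg (B.map f) x.2).trans (map_zero _))
  map_id q := by
    ext x
    exact A.map_id_apply q x.1
  map_comp f g := by
    ext x
    exact A.map_comp_apply f g x.1

/-- The inclusion `Ker d ⟶ A`. -/
def kerS.ι {A B : SimplicialObject AddCommGrpCat.{u}} (d : A ⟶ B) : kerS d ⟶ A where
  app q := AddCommGrpCat.ofHom (d.app q).hom.ker.subtype
  naturality _ _ _ := rfl

/-- The map of kernels induced by a commutative square. -/
def kerS.map {A B A' B' : SimplicialObject AddCommGrpCat.{u}} (d : A ⟶ B) (d' : A' ⟶ B')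
    (a : A ⟶ A') (b : B ⟶ B') (h : d ≫ b = a ≫ d') : kerS d ⟶ kerS d' where
  app q := AddCommGrpCat.ofHom
    (((a.app q).hom.comp (d.app q).hom.ker.subtype).codRestrict (d'.app q).hom.ker fun x => by
      have e := congrArg (fun (m : A ⟶ B') => m.app q x.1) h
      exact e.symm.trans ((congrArg (b.app q) x.2).trans (map_zero _)))
  naturality p q f := by
    ext x
    exact Subtype.ext (a.naturality_apply f x.1)

theorem kerS.hom_ext {A B : SimplicialObject AddCommGrpCat.{u}} {d : A ⟶ B}
    {C : SimplicialObject AddCommGrpCat.{u}} {f g : C ⟶ kerS d} (h : f ≫ kerS.ι d = g ≫ kerS.ι d) :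
    f = g := by
  ext q x
  exact Subtype.ext (congrArg (fun (m : C ⟶ A) => m.app q x) h)

variable {G : Type v} [Group G]

/-- The simplicial abelian `O_G`-group `Ker d`. -/
def OKer {A B : (OrbitCat G)ᵒᵖ ⥤ SimplicialObject AddCommGrpCat.{u}} (d : A ⟶ B) :
    (OrbitCat G)ᵒᵖ ⥤ SimplicialObject AddCommGrpCat.{u} where
  obj H := kerS (d.app H)
  map {K H} g := kerS.map (d.app K) (d.app H) (A.map g) (B.map g) (d.naturality g).symm
  map_id H := kerS.hom_ext (by
    change kerS.ι _ ≫ A.map (𝟙 H) = _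
    rw [A.map_id]; rfl)
  map_comp g g' := kerS.hom_ext (by
    change kerS.ι _ ≫ A.map (g ≫ g') = _
    rw [A.map_comp]; rfl)

/-- The `O_G`-object `T_0` of vertices of a simplicial abelian `O_G`-group `T`. -/
abbrev OVert (T : (OrbitCat G)ᵒᵖ ⥤ SimplicialObject AddCommGrpCat.{u}) :
    (OrbitCat G)ᵒᵖ ⥤ AddCommGrpCat.{u} :=
  T ⋙ (evaluation SimplexCategoryᵒᵖ AddCommGrpCat.{u}).obj (op ⦋0⦌)

/-- The `n`-simplices of a simplicial abelian group all of whose faces are zero. -/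
def sphericalSimplices (A : SimplicialObject AddCommGrpCat.{u}) (n : ℕ) :
    AddSubgroup (A _⦋n⦌) :=
  match n with
  | 0 => ⊤
  | _ + 1 => ⨅ i, (A.δ i).hom.ker

/-- The `n`-simplices `∂_{n+1} y` where `∂_i y = 0` for all `i ≤ n`. -/
def nullSimplices (A : SimplicialObject AddCommGrpCat.{u}) (n : ℕ) : AddSubgroup (A _⦋n⦌) :=
  (⨅ i : Fin (n + 1), (A.δ i.castSucc).hom.ker).map (A.δ (Fin.last (n + 1))).hom

/-- The `n`-th homotopy group (based at `0`) of a simplicial abelian group. -/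
abbrev homotopyGroup (A : SimplicialObject AddCommGrpCat.{u}) (n : ℕ) : Type u :=
  sphericalSimplices A n ⧸ (nullSimplices A n).addSubgroupOf (sphericalSimplices A n)

/-- A simplicial differential graded algebra over `ℤ` (associative, not required to have a unit)
with underlying simplicial graded group `A` and differential `d`. The product of degrees `i`, `j`
lands in degree `k` for every `k = i + j`. -/
structure SimplicialDGA (A : ℕ → SimplicialObject AddCommGrpCat.{u})
    (d : ∀ i, A i ⟶ A (i + 1)) where
  mul : ∀ (i j k : ℕ) (_ : i + j = k) (q : SimplexCategoryᵒᵖ),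
    (A i).obj q →+ (A j).obj q →+ (A k).obj q
  mul_assoc : ∀ (i j k ij jk n : ℕ) (hij : i + j = ij) (hjk : j + k = jk) (h : ij + k = n)
    (h' : i + jk = n) (q : SimplexCategoryᵒᵖ) (a : (A i).obj q) (b : (A j).obj q)
    (c : (A k).obj q), mul ij k n h q (mul i j ij hij q a b) c = mul i jk n h' q a (mul j k jk hjk q b c)
  /-- the faces and degeneracies are multiplicative -/
  map_mul : ∀ (i j k : ℕ) (h : i + j = k) (p q : SimplexCategoryᵒᵖ) (f : p ⟶ q)
    (a : (A i).obj p) (b : (A j).obj p),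
    (A k).map f (mul i j k h p a b) = mul i j k h q ((A i).map f a) ((A j).map f b)
  d_comp_d : ∀ i, d i ≫ d (i + 1) = 0
  leibniz : ∀ (i j k : ℕ) (h : i + j = k) (q : SimplexCategoryᵒᵖ) (a : (A i).obj q)
    (b : (A j).obj q),
    (d k).app q (mul i j k h q a b) =
      mul (i + 1) j (k + 1) (by omega) q ((d i).app q a) b +
        (-1 : ℤ) ^ i • mul i (j + 1) (k + 1) (by omega) q a ((d j).app q b)

variable (G) in
/-- Equivariant twisted Cartan cohomology theories. -/
structure CartanTheory where
  /-- the simplicial abelian `O_G`-groups `A^i` -/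
  A : ℕ → (OrbitCat G)ᵒᵖ ⥤ SimplicialObject AddCommGrpCat.{u}
  /-- the differentials -/
  d : ∀ i, A i ⟶ A (i + 1)
  /-- each `𝒜(G/H)` is a simplicial differential graded algebra -/
  dga : ∀ H : (OrbitCat G)ᵒᵖ, SimplicialDGA (fun i => (A i).obj H) (fun i => (d i).app H)
  /-- `A_p^0 → A_p^1 → A_p^2 → ⋯` is exact -/
  exactness : ∀ (i : ℕ) (H : (OrbitCat G)ᵒᵖ) (p : SimplexCategoryᵒᵖ),
    Function.Exact (((d i).app H).app p) (((d (i + 1)).app H).app p)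
  /-- the homotopy groups of `A^i` vanish -/
  homotopy_trivial : ∀ (i : ℕ) (H : (OrbitCat G)ᵒᵖ) (n : ℕ),
    Subsingleton (homotopyGroup ((A i).obj H) n)
  /-- `Z^0𝒜` is simplicially trivial: all faces and degeneracies are isomorphisms -/
  isIso_δ : ∀ (H : (OrbitCat G)ᵒᵖ) (n : ℕ) (i : Fin (n + 2)), IsIso (((OKer (d 0)).obj H).δ i)
  isIso_σ : ∀ (H : (OrbitCat G)ᵒᵖ) (n : ℕ) (i : Fin (n + 1)), IsIso (((OKer (d 0)).obj H).σ i)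
  /-- the homomorphisms `ψ_H^i : Aut((Z^0𝒜)_0(G/H)) → Aut(A^i(G/H))` -/
  ψ : ∀ (H : (OrbitCat G)ᵒᵖ) (i : ℕ), Aut ((OVert (OKer (d 0))).obj H) →* Aut ((A i).obj H)
  ψ_d : ∀ (H : (OrbitCat G)ᵒᵖ) (i : ℕ) (α : Aut ((OVert (OKer (d 0))).obj H)),
    (ψ H i α).hom ≫ (d i).app H = (d i).app H ≫ (ψ H (i + 1) α).hom
  ψ_natural : ∀ {K H : (OrbitCat G)ᵒᵖ} (g : K ⟶ H) (i : ℕ)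
    (α : Aut ((OVert (OKer (d 0))).obj H)) (β : Aut ((OVert (OKer (d 0))).obj K)),
    (OVert (OKer (d 0))).map g ≫ α.hom = β.hom ≫ (OVert (OKer (d 0))).map g →
      (A i).map g ≫ (ψ H i α).hom = (ψ K i β).hom ≫ (A i).map g

namespace CartanTheory

variable (𝒜 : CartanTheory.{u, v} G)

/-- The simplicial abelian `O_G`-group `Z^n𝒜 = Ker δ^n`. -/
abbrev Z (n : ℕ) : (OrbitCat G)ᵒᵖ ⥤ SimplicialObject AddCommGrpCat.{u} := OKer (𝒜.d n)

/-- The abelian `O_G`-group `M = (Z^0𝒜)_0`. -/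
abbrev M : (OrbitCat G)ᵒᵖ ⥤ AddCommGrpCat.{u} := OVert (𝒜.Z 0)

variable {𝒜} {π : (OrbitCat G)ᵒᵖ ⥤ GrpCat.{u}} (φ : OAction π 𝒜.M)

theorem iso_square_inv {C : Type*} [Category* C] {X Y : C} (e : X ≅ X) (e' : Y ≅ Y) (d : X ⟶ Y)
    (h : e.hom ≫ d = d ≫ e'.hom) : e.inv ≫ d = d ≫ e'.inv := by
  rw [Iso.inv_comp_eq, ← Category.assoc, h, Category.assoc, Iso.hom_inv_id, Category.comp_id]

/-- The action `ψφ` of `π` on `A^n`. -/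
def actA (n : ℕ) : OAction π (𝒜.A n) where
  ρ H := (𝒜.ψ H n).comp (φ.ρ H)
  comm g v := 𝒜.ψ_natural g n _ _ (φ.comm g v)

theorem actA_d (n : ℕ) (H : (OrbitCat G)ᵒᵖ) (v : π.obj H) :
    ((actA φ n).ρ H v).hom ≫ (𝒜.d n).app H = (𝒜.d n).app H ≫ ((actA φ (n + 1)).ρ H v).hom :=
  𝒜.ψ_d H n _

theorem actA_d_inv (n : ℕ) (H : (OrbitCat G)ᵒᵖ) (v : π.obj H) :
    ((actA φ n).ρ H v).inv ≫ (𝒜.d n).app H = (𝒜.d n).app H ≫ ((actA φ (n + 1)).ρ H v).inv := by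
  exact iso_square_inv _ _ _ (actA_d φ n H v)

/-- The restriction of the action `ψφ` to `Z^n𝒜`. -/
def actZ (n : ℕ) : OAction π (𝒜.Z n) where
  ρ H :=
    { toFun := fun v =>
        { hom := kerS.map _ _ ((actA φ n).ρ H v).hom ((actA φ (n + 1)).ρ H v).hom
            (actA_d φ n H v).symm
          inv := kerS.map _ _ ((actA φ n).ρ H v).inv ((actA φ (n + 1)).ρ H v).inv
            (actA_d_inv φ n H v).symm
          hom_inv_id := kerS.hom_ext
            (congrArg (kerS.ι _ ≫ ·) (Iso.hom_inv_id ((actA φ n).ρ H v)))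
          inv_hom_id := kerS.hom_ext
            (congrArg (kerS.ι _ ≫ ·) (Iso.inv_hom_id ((actA φ n).ρ H v))) }
      map_one' := by
        apply Iso.ext
        refine kerS.hom_ext ?_
        change kerS.ι _ ≫ ((actA φ n).ρ H 1).hom = _
        rw [map_one]; rfl
      map_mul' := fun v w => by
        apply Iso.ext
        refine kerS.hom_ext ?_
        change kerS.ι _ ≫ ((actA φ n).ρ H (v * w)).hom = _
        rw [map_mul]; rfl }
  comm {K H} g v := by
    refine kerS.hom_ext ?_
    change kerS.ι _ ≫ ((𝒜.A n).map g ≫ ((actA φ n).ρ H (π.map g v)).hom) =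
      kerS.ι _ ≫ (((actA φ n).ρ K v).hom ≫ (𝒜.A n).map g)
    rw [(actA φ n).comm g v]

end CartanTheory

end Cartan

section Lifts

variable {G : Type v} [Group G] {π : (OrbitCat G)ᵒᵖ ⥤ GrpCat.{u}}

/-- An `O_G`-twisting function `τ : B → π`, where the `O_G`-group `π` is regarded as a simplicial
`O_G`-group in the trivial way. -/
structure OTwisting (B : (OrbitCat G)ᵒᵖ ⥤ SSet.{u}) (π : (OrbitCat G)ᵒᵖ ⥤ GrpCat.{u}) where
  /-- the functions `τ(G/H)_{q+1} : B(G/H)_{q+1} → π(G/H)` -/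
  τ : ∀ (H : (OrbitCat G)ᵒᵖ) (q : ℕ), (B.obj H) _⦋q + 1⦌ → π.obj H
  twisting : ∀ H, IsTwistingFunction (B.obj H) (constGroup (π.obj H)) (τ H)
  natural : ∀ {K H : (OrbitCat G)ᵒᵖ} (g : K ⟶ H) (q : ℕ) (x : (B.obj K) _⦋q + 1⦌),
    π.map g (τ K q x) = τ H q ((B.map g).app (op ⦋q + 1⦌) x)

/-- The map `θ(τ) : B → W̄π`, `θ(τ)(x) = [τ(x), τ(∂₀x), …, τ(∂₀^{q-1}x)]`. -/
noncomputable def OTwisting.θ {B : (OrbitCat G)ᵒᵖ ⥤ SSet.{u}} (τ : OTwisting B π) :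
    B ⟶ OWBar π where
  app H := thetaMap (τ.twisting H)
  naturality K H g := by
    refine SSet.hom_ext fun q => typeHom_ext fun x => ?_
    refine WBar.ext_coord (q := q.unop.len) fun i => ?_
    have hi := i.isLt
    let m := q.unop.len - 1 - i.val
    have hm : i.val + (m + 1) = q.unop.len := by omega
    refine (coord_thetaSimplex (q := q.unop.len) (τ.τ H) ((B.map g).app q x) i m hm).trans ?_
    refine Eq.trans ?_ (congrArg (π.map g)
      (coord_thetaSimplex (q := q.unop.len) (τ.τ K) x i m hm)).symm
    rw [τ.natural]
    exact congrArg _ ((B.map g).naturality_apply (lastFace q.unop.len i.val m hm).op x).symm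

variable {B : (OrbitCat G)ᵒᵖ ⥤ SSet.{u}}

/-- The set of liftings of `θ : B → W̄π` to `T ×_{τ(π)} W̄π`. -/
def Lifts {T : (OrbitCat G)ᵒᵖ ⥤ SSet.{u}} (a : OAction π T) (θ : B ⟶ OWBar π) : Type (max u v) :=
  { f : B ⟶ OTCP a // f ≫ OTCP.proj a = θ }

/-- Vertical homotopy of liftings of `θ`: a map `F : B × Δ[1] → T ×_{τ(π)} W̄π` of `O_G`-simplicial
sets which is a homotopy from `f(G/H)` to `f'(G/H)` for every `H`, with `p ∘ F = θ ∘ pr₁`. -/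
def VertHomotopic {T : (OrbitCat G)ᵒᵖ ⥤ SSet.{u}} {a : OAction π T} {θ : B ⟶ OWBar π}
    (f f' : Lifts a θ) : Prop :=
  ∃ F : (B ⋙ tensorRight (Δ[1] : SSet.{u})) ⟶ OTCP a,
    ∀ H, SSet.ι₀ ≫ F.app H = f.1.app H ∧ SSet.ι₁ ≫ F.app H = f'.1.app H ∧
      F.app H ≫ (OTCP.proj a).app H =
        SemiCartesianMonoidalCategory.fst (B.obj H) Δ[1] ≫ θ.app H

namespace Lifts

/-- The first (fibre) component `c` of `f(x) = (c, θ(x))`. -/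
def fibre {T : (OrbitCat G)ᵒᵖ ⥤ SSet.{u}} {a : OAction π T} {θ : B ⟶ OWBar π} (f : Lifts a θ)
    (H : (OrbitCat G)ᵒᵖ) (q : SimplexCategoryᵒᵖ) (x : (B.obj H).obj q) : (T.obj H).obj q :=
  Prod.fst (show (T.obj H).obj q × (WBar (π.obj H)).obj q from (f.1.app H).app q x)

theorem app_eq {T : (OrbitCat G)ᵒᵖ ⥤ SSet.{u}} {a : OAction π T} {θ : B ⟶ OWBar π} (f : Lifts a θ)
    (H : (OrbitCat G)ᵒᵖ) (q : SimplexCategoryᵒᵖ) (x : (B.obj H).obj q) :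
    (f.1.app H).app q x = (f.fibre H q x, (θ.app H).app q x) := by
  refine Prod.ext rfl ?_
  exact congrArg (fun (m : B ⟶ OWBar π) => (m.app H).app q x) f.2

theorem ext_fibre {T : (OrbitCat G)ᵒᵖ ⥤ SSet.{u}} {a : OAction π T} {θ : B ⟶ OWBar π}
    {f f' : Lifts a θ} (h : ∀ H q x, f.fibre H q x = f'.fibre H q x) : f = f' := by
  refine Subtype.ext (NatTrans.ext (funext fun H => SSet.hom_ext fun q => typeHom_ext fun x => ?_))
  rw [f.app_eq, f'.app_eq, h]

section

variable {T : (OrbitCat G)ᵒᵖ ⥤ SSet.{u}} (a : OAction π T) (θ : B ⟶ OWBar π)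

/-- The element of `π(G/H)` by which the simplicial operator `f` twists the fibre coordinate over
the simplex `x`. -/
def twist (H : (OrbitCat G)ᵒᵖ) {p q : SimplexCategoryᵒᵖ} (f : p ⟶ q) (x : (B.obj H).obj p) :
    π.obj H :=
  WBar.edge (P := π.obj H) ((θ.app H).app p x) (Fin.zero_le (f.unop.toOrderHom 0))

/-- The condition on `c` for `x ↦ (c(x), θ(x))` to be a lifting of `θ`. -/
structure IsFibre (c : ∀ H q, (B.obj H).obj q → (T.obj H).obj q) : Prop where
  simplicial : ∀ (H : (OrbitCat G)ᵒᵖ) {p q : SimplexCategoryᵒᵖ} (f : p ⟶ q) (x : (B.obj H).obj p),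
    c H q ((B.obj H).map f x) =
      (a.ρ H (twist θ H f x)).hom.app q ((T.obj H).map f (c H p x))
  natural : ∀ {K H : (OrbitCat G)ᵒᵖ} (g : K ⟶ H) (q : SimplexCategoryᵒᵖ) (x : (B.obj K).obj q),
    c H q ((B.map g).app q x) = (T.map g).app q (c K q x)

variable {a θ}

/-- The lifting `x ↦ (c(x), θ(x))`. -/
def mk (c : ∀ H q, (B.obj H).obj q → (T.obj H).obj q) (hc : IsFibre a θ c) : Lifts a θ :=
  ⟨{ app := fun H =>
      { app := fun q => TypeCat.ofHom fun x => (c H q x, (θ.app H).app q x)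
        naturality := fun p q f => by
          refine typeHom_prod_ext (fun x => hc.simplicial H f x) fun x => ?_
          exact (θ.app H).naturality_apply f x }
     naturality := fun K H g => by
      refine SSet.hom_ext fun q => typeHom_prod_ext (fun x => hc.natural g q x) fun x => ?_
      exact congrArg (fun (m : B.obj K ⟶ (OWBar π).obj H) => m.app q x) (θ.naturality g) }, rfl⟩

theorem isFibre_fibre (f : Lifts a θ) : IsFibre a θ f.fibre where
  simplicial H p q s x := by
    have h := congrArg Prod.fst ((f.1.app H).naturality_apply s x)
    refine h.trans ?_
    rw [f.app_eq]
    rfl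
  natural {K H} g q x :=
    congrArg (fun (m : B.obj K ⟶ (OTCP a).obj H) => (m.app q x).1) (f.1.naturality g)

end

section

variable {T : (OrbitCat G)ᵒᵖ ⥤ SimplicialObject AddCommGrpCat.{u}} {a : OAction π T}
  {θ : B ⟶ OWBar π}

/-- The fibre component as an element of the abelian group `T(G/H)_q`. -/
def coeff (f : Lifts (a.comp underlying) θ) (H : (OrbitCat G)ᵒᵖ) (q : SimplexCategoryᵒᵖ)
    (x : (B.obj H).obj q) : (T.obj H).obj q := f.fibre H q x

/-- The lifting `x ↦ (c(x), θ(x))`. -/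
def ofCoeff (c : ∀ H q, (B.obj H).obj q → (T.obj H).obj q)
    (h₁ : ∀ (H : (OrbitCat G)ᵒᵖ) {p q : SimplexCategoryᵒᵖ} (s : p ⟶ q) (x : (B.obj H).obj p),
      c H q ((B.obj H).map s x) = (a.ρ H (twist θ H s x)).hom.app q ((T.obj H).map s (c H p x)))
    (h₂ : ∀ {K H : (OrbitCat G)ᵒᵖ} (g : K ⟶ H) (q : SimplexCategoryᵒᵖ) (x : (B.obj K).obj q),
      c H q ((B.map g).app q x) = (T.map g).app q (c K q x)) : Lifts (a.comp underlying) θ :=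
  mk c ⟨h₁, h₂⟩

theorem coeff_simplicial (f : Lifts (a.comp underlying) θ) (H : (OrbitCat G)ᵒᵖ)
    {p q : SimplexCategoryᵒᵖ} (s : p ⟶ q) (x : (B.obj H).obj p) :
    f.coeff H q ((B.obj H).map s x) =
      (a.ρ H (twist θ H s x)).hom.app q ((T.obj H).map s (f.coeff H p x)) :=
  f.isFibre_fibre.simplicial H s x

theorem coeff_natural (f : Lifts (a.comp underlying) θ) {K H : (OrbitCat G)ᵒᵖ} (g : K ⟶ H)
    (q : SimplexCategoryᵒᵖ) (x : (B.obj K).obj q) :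
    f.coeff H q ((B.map g).app q x) = (T.map g).app q (f.coeff K q x) :=
  f.isFibre_fibre.natural g q x

/-- The zero lifting `x ↦ (0, θ(x))`. -/
instance : Zero (Lifts (a.comp underlying) θ) where
  zero := ofCoeff (fun _ _ _ => 0) (fun _ _ _ _ _ => by simp) (fun _ _ _ => by simp)

/-- Fibrewise addition. -/
instance : Add (Lifts (a.comp underlying) θ) where
  add f f' := ofCoeff (fun H q x => f.coeff H q x + f'.coeff H q x)
    (fun H p q s x => by rw [coeff_simplicial, coeff_simplicial, map_add, map_add])
    (fun g q x => by rw [coeff_natural, coeff_natural, map_add])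

/-- Fibrewise inversion. -/
instance : Neg (Lifts (a.comp underlying) θ) where
  neg f := ofCoeff (fun H q x => -f.coeff H q x)
    (fun H p q s x => by rw [coeff_simplicial, map_neg, map_neg])
    (fun g q x => by rw [coeff_natural, map_neg])

theorem coeff_zero (H : (OrbitCat G)ᵒᵖ) (q : SimplexCategoryᵒᵖ) (x : (B.obj H).obj q) :
    (0 : Lifts (a.comp underlying) θ).coeff H q x = 0 := rfl

theorem coeff_add (f f' : Lifts (a.comp underlying) θ) (H : (OrbitCat G)ᵒᵖ)
    (q : SimplexCategoryᵒᵖ) (x : (B.obj H).obj q) :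
    (f + f').coeff H q x = f.coeff H q x + f'.coeff H q x := rfl

theorem coeff_neg (f : Lifts (a.comp underlying) θ) (H : (OrbitCat G)ᵒᵖ)
    (q : SimplexCategoryᵒᵖ) (x : (B.obj H).obj q) : (-f).coeff H q x = -f.coeff H q x := rfl

theorem ext_coeff {f f' : Lifts (a.comp underlying) θ}
    (h : ∀ H q x, f.coeff H q x = f'.coeff H q x) : f = f' := ext_fibre h

instance : AddCommGroup (Lifts (a.comp underlying) θ) :=
  { AddGroup.ofLeftAxioms
      (fun f f' f'' => ext_coeff fun H q x => by simp only [coeff_add, add_assoc])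
      (fun f => ext_coeff fun H q x => by simp only [coeff_add, coeff_zero, zero_add])
      (fun f => ext_coeff fun H q x => by
        simp only [coeff_add, coeff_neg, coeff_zero, neg_add_cancel]) with
    add_comm := fun f f' => ext_coeff fun H q x => by
      simp only [coeff_add]; exact add_comm _ _ }

variable {T' : (OrbitCat G)ᵒᵖ ⥤ SimplicialObject AddCommGrpCat.{u}} {a' : OAction π T'}

/-- The homomorphism `f ↦ ((m × id) ∘ f)` on liftings induced by an equivariant homomorphism `m`
of simplicial abelian `O_G`-groups. -/
def push (m : T ⟶ T') (hm : ∀ H (v : π.obj H), (a.ρ H v).hom ≫ m.app H = m.app H ≫ (a'.ρ H v).hom) :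
    Lifts (a.comp underlying) θ →+ Lifts (a'.comp underlying) θ where
  toFun f := ⟨f.1 ≫ OTCP.mapFibre (a.comp underlying) (a'.comp underlying)
    (Functor.whiskerRight m underlying) (fun H v => congrArg underlying.map (hm H v)), f.2⟩
  map_zero' := ext_coeff fun H q x => map_zero ((m.app H).app q).hom
  map_add' f f' := ext_coeff fun H q x =>
    map_add ((m.app H).app q).hom (f.coeff H q x) (f'.coeff H q x)

theorem coeff_push (m : T ⟶ T')
    (hm : ∀ H (v : π.obj H), (a.ρ H v).hom ≫ m.app H = m.app H ≫ (a'.ρ H v).hom)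
    (f : Lifts (a.comp underlying) θ) (H : (OrbitCat G)ᵒᵖ) (q : SimplexCategoryᵒᵖ)
    (x : (B.obj H).obj q) : (push m hm f).coeff H q x = (m.app H).app q (f.coeff H q x) := rfl

end

end Lifts

end Lifts

namespace CartanTheory

variable {G : Type v} [Group G] {𝒜 : CartanTheory.{u, v} G} {π : (OrbitCat G)ᵒᵖ ⥤ GrpCat.{u}}
  {B : (OrbitCat G)ᵒᵖ ⥤ SSet.{u}}

/-- The abelian group `A_φ^n(X; τ)` of liftings of `θ(τ)` to `A^n ×_{τ(π)} W̄π` (here `B = ΦX`). -/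
abbrev LiftGroup (φ : OAction π 𝒜.M) (τ : OTwisting B π) (n : ℕ) : Type (max u v) :=
  Lifts ((actA φ n).comp underlying) τ.θ

/-- The set of liftings of `θ(τ)` to `Z^n𝒜 ×_{τ(π)} W̄π`. -/
abbrev ZLifts (φ : OAction π 𝒜.M) (τ : OTwisting B π) (n : ℕ) : Type (max u v) :=
  Lifts ((actZ φ n).comp underlying) τ.θ

/-- The differential `(δ̄^n f)(x) = (δ^n c, b)` where `f(x) = (c, b)`. -/
noncomputable def dbar (φ : OAction π 𝒜.M) (τ : OTwisting B π) (n : ℕ) :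
    LiftGroup φ τ n →+ LiftGroup φ τ (n + 1) :=
  Lifts.push (𝒜.d n) (actA_d φ n)

theorem dbar_dbar (φ : OAction π 𝒜.M) (τ : OTwisting B π) (n : ℕ) (f : LiftGroup φ τ n) :
    dbar φ τ (n + 1) (dbar φ τ n f) = 0 :=
  Lifts.ext_coeff fun H q x =>
    congrArg (fun m : (𝒜.A n).obj H ⟶ (𝒜.A (n + 2)).obj H => m.app q (f.coeff H q x))
      ((𝒜.dga H).d_comp_d n)

/-- The cochain complex `A_φ^*(X; τ)`. -/
noncomputable def liftComplex (φ : OAction π 𝒜.M) (τ : OTwisting B π) :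
    CochainComplex AddCommGrpCat.{max u v} ℕ :=
  CochainComplex.of (fun n => AddCommGrpCat.of (LiftGroup φ τ n))
    (fun n => AddCommGrpCat.ofHom (dbar φ τ n))
    (fun n => by ext f; exact dbar_dbar φ τ n f)

theorem liftComplex_d (φ : OAction π 𝒜.M) (τ : OTwisting B π) (n : ℕ) :
    (liftComplex φ τ).d n (n + 1) = AddCommGrpCat.ofHom (dbar φ τ n) :=
  CochainComplex.of_d (V := AddCommGrpCat.{max u v})
    (fun n => AddCommGrpCat.of (LiftGroup φ τ n))
    (fun n => AddCommGrpCat.ofHom (dbar φ τ n)) n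

/-- The inclusion `Z^n𝒜 → A^n`. -/
def inclZ (𝒜 : CartanTheory.{u, v} G) (n : ℕ) : 𝒜.Z n ⟶ 𝒜.A n where
  app H := kerS.ι ((𝒜.d n).app H)
  naturality _ _ _ := rfl

/-- A lifting to `Z^n𝒜 ×_{τ(π)} W̄π`, regarded as a lifting to `A^n ×_{τ(π)} W̄π`. -/
noncomputable def toLift (φ : OAction π 𝒜.M) (τ : OTwisting B π) (n : ℕ) :
    ZLifts φ τ n →+ LiftGroup φ τ n :=
  Lifts.push (inclZ 𝒜 n) (fun _ _ => rfl)

theorem dbar_toLift (φ : OAction π 𝒜.M) (τ : OTwisting B π) (n : ℕ) (f : ZLifts φ τ n) :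
    dbar φ τ n (toLift φ τ n f) = 0 :=
  Lifts.ext_coeff fun H q x =>
    (show (kerS ((𝒜.d n).app H)).obj q from f.coeff H q x).2

/-- The cohomology class in `H^n(A_φ^*(X; τ))` of a lifting to `Z^n𝒜 ×_{τ(π)} W̄π`, which is an
`n`-cocycle when regarded as a lifting to `A^n ×_{τ(π)} W̄π`. -/
noncomputable def cohomologyClass (φ : OAction π 𝒜.M) (τ : OTwisting B π) (n : ℕ) :
    ZLifts φ τ n →+ (liftComplex φ τ).homology n :=
  ((liftComplex φ τ).liftCycles (A := AddCommGrpCat.of (ZLifts φ τ n))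
    (AddCommGrpCat.ofHom (toLift φ τ n)) (n + 1) (by simp)
    (by
      refine (congrArg (AddCommGrpCat.ofHom (toLift φ τ n) ≫ ·) (liftComplex_d φ τ n)).trans ?_
      ext f
      exact dbar_toLift φ τ n f) ≫ (liftComplex φ τ).homologyπ n).hom

end CartanTheory

/-! Two lifts to the cocycles are vertically homotopic exactly when they have the same cohomology
class (`vertHomotopic_iff_cohomologyClass_eq`). Every class comes from such a lift, so the class map
induces the bijection, and vertical homotopy is an equivalence relation because it is the kernel
relation of a map.

Let n = m + 1. Exactness makes δ a surjection of A^m onto Z^n. Given a homotopy from f to f',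
subtract the constant homotopy at f: the result is a lift over the cylinder ΦX × Δ[1] that is zero
at the end 0. If it lifts through δ to a cochain over the cylinder starting at zero, the value h of
this cochain at the end 1 satisfies δ̄h = f' − f. Conversely, given h, prescribe 0 at the end 0 and
h at the end 1. If this extends to a cochain over the cylinder with values in A^m, then applying δ
and adding the constant homotopy at f gives a homotopy from f to f'. For n = 0 there are no
coboundaries, and a homotopy is constant because Z^0 is simplicially constant.

Two extension problems remain. For a single fibre they are classical: a surjection of simplicial
abelian groups is a Kan fibration (`rlp_J_of_surjective`), and a simplicial abelian group with zero
homotopy is a contractible Kan complex (`rlp_I_of_acyclic`). The twisting is harmless because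
lifting properties are tested over standard simplices, where it can be undone
(`hasLiftingProperty_twistedProduct`). For naturality in G/H, each set of q-simplices of ΦX is a
coproduct of representable functors (`isCellular_Phi`), so values may be chosen freely on orbit
representatives. Induction on the dimension then lifts any map from ΦX through an objectwise trivial
fibration (`exists_lift`). Extension over ΦX × L from ΦX × K reduces to this by the exponential law:
E^L → E^K ×_{E'^K} E'^L is a trivial fibration if E → E' is a Kan fibration and K ⊆ L is anodyne, or
if E → E' is a trivial fibration (`exists_lift_tensor`). -/

namespace SimplicialExtension

/-! ### Horn and boundary fillers in simplicial abelian groups -/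

variable {A Z : SimplicialObject AddCommGrpCat.{u}} {n : ℕ}

/-- The vertex map of a simplex of `Δ[n]`. -/
abbrev vert {m : SimplexCategoryᵒᵖ} (a : (Δ[n] : SSet.{u}).obj m) :
    Fin (m.unop.len + 1) →o Fin (n + 1) := SSet.stdSimplex.asOrderHom a

theorem vert_ext {m : SimplexCategoryᵒᵖ} {a b : (Δ[n] : SSet.{u}).obj m}
    (h : ∀ k, vert a k = vert b k) : a = b := by
  apply SSet.stdSimplex.objEquiv.injective
  ext k
  exact congrArg Fin.val (h k)

/-- The map `w + x ∘ e - w ∘ e`. -/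
def correct {K : (Δ[n] : SSet.{u}).Subcomplex} (x : (K : SSet.{u}) ⟶ underlying.obj A)
    (w : Δ[n] ⟶ underlying.obj A) (e : (⦋n⦌ : SimplexCategory) ⟶ ⦋n⦌)
    (he : ∀ m (a : (Δ[n] : SSet.{u}).obj m), (SSet.stdSimplex.map e).app m a ∈ K.obj m) :
    Δ[n] ⟶ underlying.obj A where
  app m := TypeCat.ofHom fun a => (show A.obj m from w.app m a) +
    (show A.obj m from x.app m ⟨_, he m a⟩) -
    (show A.obj m from w.app m ((SSet.stdSimplex.map e).app m a))
  naturality m m' f := by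
    refine typeHom_ext fun a => ?_
    have h1 := w.naturality_apply f a
    have h2 := x.naturality_apply f ⟨_, he m a⟩
    have h3 := w.naturality_apply f ((SSet.stdSimplex.map e).app m a)
    refine Eq.trans ?_ (((map_sub (A.map f).hom _ _).trans
      (congrArg (· - _) (map_add (A.map f).hom _ _))).symm)
    exact congrArg₂ (fun s t : A.obj m' => s - t)
      (congrArg₂ (fun s t : A.obj m' => s + t) h1 h2) h3

/-- `w` extends `x` on the faces opposite to the vertices in `T`. -/
def AgreesOn {K : (Δ[n] : SSet.{u}).Subcomplex} {Y : SSet.{u}} (x : (K : SSet.{u}) ⟶ Y)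
    (w : Δ[n] ⟶ Y) (T : Set (Fin (n + 1))) : Prop :=
  ∀ i ∈ T, ∀ (m : SimplexCategoryᵒᵖ) (a : (Δ[n] : SSet.{u}).obj m) (ha : a ∈ K.obj m),
    (∀ k, vert a k ≠ i) → w.app m a = x.app m ⟨a, ha⟩

/-- The operator `[n] → [n]` which moves the vertex `j` to `j'` and fixes all others. -/
def moveVertex (j j' : Fin (n + 1)) (h : j'.val = j.val + 1 ∨ j.val = j'.val + 1) :
    (⦋n⦌ : SimplexCategory) ⟶ ⦋n⦌ :=
  SimplexCategory.mkHom
    { toFun := fun k => if k = j then j' else k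
      monotone' := fun a b hab => by
        simp only [Fin.le_def, Fin.ext_iff] at hab ⊢
        split_ifs <;> omega }

theorem vert_moveVertex (j j' : Fin (n + 1)) (h : j'.val = j.val + 1 ∨ j.val = j'.val + 1)
    {m : SimplexCategoryᵒᵖ} (a : (Δ[n] : SSet.{u}).obj m) (k) :
    vert ((SSet.stdSimplex.{u}.map (moveVertex j j' h)).app m a) k =
      if vert a k = j then j' else vert a k := rfl

/-- Take w' = w + x∘e − w∘e, where e moves j to its neighbour j'. The image of e avoids j, so x∘e is
defined, and x∘e and w∘e have the same image under p. On the face opposite j the operator e is the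
identity and w' = x. On a face opposite some other i ∈ T, e stays in that face because j' ∉ T, so
x∘e = w∘e there and nothing already achieved is lost. -/
theorem exists_agreesOn_insert {K : (Δ[n] : SSet.{u}).Subcomplex} (p : A ⟶ Z)
    (x : (K : SSet.{u}) ⟶ underlying.obj A) (w : Δ[n] ⟶ underlying.obj A)
    (z : Δ[n] ⟶ underlying.obj Z) (hx : x ≫ underlying.map p = K.ι ≫ z)
    (hw : w ≫ underlying.map p = z) (T : Set (Fin (n + 1))) (j j' : Fin (n + 1))
    (h : j'.val = j.val + 1 ∨ j.val = j'.val + 1) (hj' : j' ∉ T)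
    (hK : ∀ m (a : (Δ[n] : SSet.{u}).obj m), (∀ k, vert a k ≠ j) → a ∈ K.obj m)
    (hT : AgreesOn x w T) :
    ∃ w' : Δ[n] ⟶ underlying.obj A, w' ≫ underlying.map p = z ∧ AgreesOn x w' (insert j T) := by
  have hjj : j' ≠ j := fun e => by rw [e] at h; omega
  have he : ∀ m (a : (Δ[n] : SSet.{u}).obj m),
      (SSet.stdSimplex.map (moveVertex j j' h)).app m a ∈ K.obj m := fun m a => hK m _ fun k => by
    rw [vert_moveVertex]; split_ifs with hk
    · exact hjj
    · exact hk
  refine ⟨correct x w _ he, ?_, ?_⟩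
  · refine SSet.hom_ext fun m => typeHom_ext fun a => ?_
    have hwm : ∀ b, (p.app m).hom (show A.obj m from w.app m b) = z.app m b :=
      fun b => congrArg (fun (f : Δ[n] ⟶ underlying.obj Z) => f.app m b) hw
    have hxm : ∀ b : K.obj m, (p.app m).hom (show A.obj m from x.app m b) = z.app m b.1 :=
      fun b => congrArg (fun (f : (K : SSet.{u}) ⟶ underlying.obj Z) => f.app m b) hx
    refine (map_sub (p.app m).hom _ _).trans ?_
    rw [map_add, hwm, hxm, hwm]
    exact add_sub_cancel_right (G := Z.obj m) _ _
  · intro i hi m a ha hai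
    by_cases hij : i = j
    · subst hij
      have hea : (SSet.stdSimplex.map (moveVertex i j' h)).app m a = a := vert_ext fun k => by
        rw [vert_moveVertex, if_neg (hai k)]
      change (show A.obj m from w.app m a) + (show A.obj m from x.app m ⟨_, he m a⟩) -
        (show A.obj m from w.app m ((SSet.stdSimplex.map (moveVertex i j' h)).app m a)) = _
      simp only [hea]
      exact add_sub_cancel_left (G := A.obj m) _ _
    · have hiT : i ∈ T := hi.resolve_left hij
      have hia : ∀ k, vert ((SSet.stdSimplex.map (moveVertex j j' h)).app m a) k ≠ i := fun k => by
        rw [vert_moveVertex]; split_ifs with hk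
        · rintro rfl; exact hj' hiT
        · exact hai k
      refine Eq.trans ?_ (hT i hiT m a ha hai)
      change (show A.obj m from w.app m a) + (show A.obj m from x.app m ⟨_, he m a⟩) -
        (show A.obj m from w.app m ((SSet.stdSimplex.map (moveVertex j j' h)).app m a)) = _
      rw [hT i hiT m _ (he m a) hia]
      exact add_sub_cancel_right (G := A.obj m) _ _

/-- If all faces of `Δ[n]` opposite to the vertices `< k` lie in `K`, then a map can be corrected
to extend `x` on these faces. -/
theorem exists_agreesOn_lt {K : (Δ[n] : SSet.{u}).Subcomplex} (p : A ⟶ Z)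
    (x : (K : SSet.{u}) ⟶ underlying.obj A) (w : Δ[n] ⟶ underlying.obj A)
    (z : Δ[n] ⟶ underlying.obj Z) (hx : x ≫ underlying.map p = K.ι ≫ z)
    (hw : w ≫ underlying.map p = z) (k : Fin (n + 1))
    (hK : ∀ j < k, ∀ m (a : (Δ[n] : SSet.{u}).obj m), (∀ k, vert a k ≠ j) → a ∈ K.obj m) :
    ∃ w' : Δ[n] ⟶ underlying.obj A, w' ≫ underlying.map p = z ∧ AgreesOn x w' {j | j < k} := by
  obtain ⟨k, hk⟩ := k
  induction k with
  | zero => exact ⟨w, hw, fun i hi => absurd hi (by simp)⟩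
  | succ k ih =>
    obtain ⟨w', hw', hT⟩ := ih (by omega) fun j hj => hK j (by simp [Fin.lt_def] at hj ⊢; omega)
    -- Going upwards, the vertex k is moved to k + 1, whose opposite face has not been treated yet.
    obtain ⟨w'', hw'', hT'⟩ := exists_agreesOn_insert p x w' z hx hw' _ ⟨k, by omega⟩ ⟨k + 1, hk⟩
      (Or.inl rfl) (by simp [Fin.lt_def]) (hK _ (by simp [Fin.lt_def])) hT
    refine ⟨w'', hw'', fun i hi => hT' i ?_⟩
    simp only [Set.mem_ofPred_eq, Set.mem_insert_iff, Fin.lt_def, Fin.ext_iff] at hi ⊢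
    omega

/-- Each correction needs an adjacent vertex whose face is still untreated. Faces below k are
treated upwards and faces above k downwards from n, so both sweeps move vertices towards k, which is
never treated. -/
theorem exists_agreesOn_ne {K : (Δ[n] : SSet.{u}).Subcomplex} (p : A ⟶ Z)
    (x : (K : SSet.{u}) ⟶ underlying.obj A) (w : Δ[n] ⟶ underlying.obj A)
    (z : Δ[n] ⟶ underlying.obj Z) (hx : x ≫ underlying.map p = K.ι ≫ z)
    (hw : w ≫ underlying.map p = z) (k : Fin (n + 1))
    (hK : ∀ j, j ≠ k → ∀ m (a : (Δ[n] : SSet.{u}).obj m), (∀ k, vert a k ≠ j) → a ∈ K.obj m) :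
    ∃ w' : Δ[n] ⟶ underlying.obj A, w' ≫ underlying.map p = z ∧ AgreesOn x w' {j | j ≠ k} := by
  obtain ⟨w, hw, hT⟩ := exists_agreesOn_lt p x w z hx hw k fun j hj => hK j hj.ne
  have key : ∀ r : ℕ, ∃ w' : Δ[n] ⟶ underlying.obj A, w' ≫ underlying.map p = z ∧
      AgreesOn x w' {j | j < k ∨ (k < j ∧ n < j.val + r)} := by
    intro r
    induction r with
    | zero => exact ⟨w, hw, fun i hi => hT i (hi.resolve_right fun h => by have := h.2; omega)⟩
    | succ r ih =>
      obtain ⟨w', hw', hT⟩ := ih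
      by_cases hr : k.val + r < n
      -- The vertex n − r lies above k, so n − r − 1 is at least k and is untreated. In the other
      -- case all vertices above k are already covered.
      · obtain ⟨w'', hw'', hT'⟩ := exists_agreesOn_insert p x w' z hx hw' _ ⟨n - r, by omega⟩
          ⟨n - r - 1, by omega⟩ (Or.inr (by simp; omega))
          (by simp only [Set.mem_ofPred_eq, Fin.lt_def]; omega)
          (hK _ (by simp only [ne_eq, Fin.ext_iff]; omega)) hT
        refine ⟨w'', hw'', fun i hi => hT' i ?_⟩
        simp only [Set.mem_ofPred_eq, Set.mem_insert_iff, Fin.lt_def, Fin.ext_iff] at hi ⊢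
        omega
      · refine ⟨w', hw', fun i hi => hT i ?_⟩
        simp only [Set.mem_ofPred_eq, Fin.lt_def] at hi ⊢
        omega
  obtain ⟨w', hw', hT'⟩ := key (n + 1)
  refine ⟨w', hw', fun i hi => hT' i ?_⟩
  simp only [Set.mem_ofPred_eq, Fin.lt_def, Fin.ext_iff, ne_eq] at hi ⊢
  omega

/-- A surjective homomorphism of simplicial abelian groups is a Kan fibration. -/
theorem rlp_J_of_surjective (p : A ⟶ Z) (hp : ∀ q, Function.Surjective (p.app q)) :
    SSet.modelCategoryQuillen.J.rlp (underlying.map p) := by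
  intro _ _ _ h
  simp only [SSet.modelCategoryQuillen.J, MorphismProperty.iSup_iff] at h
  obtain ⟨n, ⟨k⟩⟩ := h
  refine ⟨fun {x z} sq => ?_⟩
  -- Any preimage of the top simplex serves as a first filler; only its values on the horn have to
  -- be corrected.
  obtain ⟨y, hy⟩ := hp _ (SSet.yonedaEquiv z)
  obtain ⟨w, hw, hT⟩ := exists_agreesOn_ne p x
    (SSet.yonedaEquiv.symm (show (underlying.obj A).obj (op ⦋n + 1⦌) from y)) z sq.w
    (by
      apply SSet.yonedaEquiv.injective
      refine Eq.trans ?_ hy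
      rw [SSet.yonedaEquiv_comp, Equiv.apply_symm_apply]; rfl) k
    (fun j hj m a ha => by
      rw [SSet.mem_horn_iff]
      intro e
      have := e.symm ▸ Set.mem_univ j
      rcases this with ⟨l, hl⟩ | hl
      · exact ha l hl
      · exact hj hl)
  refine ⟨⟨⟨w, ?_, hw⟩⟩⟩
  refine SSet.hom_ext fun m => typeHom_ext fun ⟨a, ha⟩ => ?_
  have ha' := ha
  rw [SSet.mem_horn_iff, Set.ne_univ_iff_exists_notMem] at ha'
  obtain ⟨i, hi⟩ := ha'
  exact hT i (fun e => hi (Or.inr e)) m a ha fun l hl => hi (Or.inl ⟨l, hl⟩)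

theorem exists_comp_δ {m : SimplexCategoryᵒᵖ} (a : (Δ[n + 1] : SSet.{u}).obj m) (i : Fin (n + 2))
    (ha : ∀ k, vert a k ≠ i) : ∃ a' : (Δ[n] : SSet.{u}).obj m,
      (SSet.stdSimplex.δ i).app m a' = a := by
  induction m using Opposite.rec with | _ m =>
  induction m using SimplexCategory.rec with | _ m =>
  obtain ⟨a', h⟩ := SimplexCategory.eq_comp_δ_of_not_surjective' (SSet.stdSimplex.objEquiv a) i ha
  exact ⟨SSet.stdSimplex.objEquiv.symm a', SSet.stdSimplex.objEquiv.injective h.symm⟩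

/-- A simplicial abelian group with vanishing homotopy groups is a contractible Kan complex. -/
theorem rlp_I_of_acyclic (p : A ⟶ Z) [∀ q, Subsingleton (Z.obj q)]
    (hA : ∀ n, Subsingleton (homotopyGroup A n)) :
    SSet.modelCategoryQuillen.I.rlp (underlying.map p) := by
  rintro _ _ _ ⟨n⟩
  have hZ : ∀ {X : SSet.{u}} (f g : X ⟶ underlying.obj Z), f = g := fun {X} f g =>
    SSet.hom_ext fun q => typeHom_ext fun a => Subsingleton.elim (α := Z.obj q) _ _
  refine ⟨fun {x z} sq => ?_⟩
  suffices h : ∃ w : Δ[n] ⟶ underlying.obj A, ∀ i m a ha, (∀ k, vert a k ≠ i) →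
      w.app m a = x.app m ⟨a, ha⟩ by
    obtain ⟨w, hT⟩ := h
    refine ⟨⟨⟨w, ?_, hZ _ _⟩⟩⟩
    refine SSet.hom_ext fun m => typeHom_ext fun ⟨a, ha⟩ => ?_
    have ha' : ¬ Function.Surjective (vert a) := ha
    simp only [Function.Surjective, not_forall, not_exists] at ha'
    obtain ⟨i, hi⟩ := ha'
    exact hT i m a ha hi
  obtain _ | n := n
  · refine ⟨SSet.yonedaEquiv.symm (show (underlying.obj A).obj (op ⦋0⦌) from (0 : A _⦋0⦌)),
      fun i m a ha h => absurd (Subsingleton.elim (α := Fin 1) _ _) (h 0)⟩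
  have hK : ∀ j, ∀ m (a : (Δ[n + 1] : SSet.{u}).obj m), (∀ k, vert a k ≠ j) →
      a ∈ (SSet.boundary (n + 1)).obj m := fun j m a h hs => by
    obtain ⟨k, hk⟩ := hs j
    exact h k hk
  obtain ⟨w, hw, hT⟩ := exists_agreesOn_ne p x
    -- Correcting the zero simplex solves the problem on every face except the last.
    (SSet.yonedaEquiv.symm (show (underlying.obj A).obj (op ⦋n + 1⦌) from (0 : A _⦋n + 1⦌))) z sq.w
    (hZ _ _) (Fin.last _) (fun j _ => hK j)
  let d : (Δ[n + 1] : SSet.{u}) _⦋n⦌ :=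
    SSet.stdSimplex.objEquiv.symm (SimplexCategory.δ (Fin.last (n + 1)))
  have hd : d ∈ (SSet.boundary (n + 1)).obj _ := hK (Fin.last _) _ _ fun k => by
    exact Fin.succAbove_ne _ _
  -- The remaining error on the last face. Its own faces lie in faces where `w` is already right, so
  -- `y` is spherical.
  let y : A _⦋n⦌ := (show A _⦋n⦌ from x.app _ ⟨d, hd⟩) - (show A _⦋n⦌ from w.app _ d)
  have hy : y ∈ sphericalSimplices A n := by
    obtain _ | n := n
    · exact AddSubgroup.mem_top _
    · refine AddSubgroup.mem_iInf.2 fun i => ?_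
      refine (map_sub (A.δ i).hom _ _).trans (sub_eq_zero.2 ?_)
      refine ((x.naturality_apply (SimplexCategory.δ i).op ⟨d, hd⟩).symm.trans ?_).trans
        (w.naturality_apply (SimplexCategory.δ i).op d)
      refine (hT i.castSucc (Fin.castSucc_lt_last i).ne _ _ _ fun k => ?_).symm
      change (Fin.last _).succAbove (i.succAbove k) ≠ _
      rw [Fin.succAbove_last]
      exact fun e => Fin.succAbove_ne _ _ (Fin.castSucc_injective _ e)
  have hy' : y ∈ nullSimplices A n := by
    have := (QuotientAddGroup.eq_zero_iff (N := (nullSimplices A n).addSubgroupOf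
      (sphericalSimplices A n)) ⟨y, hy⟩).1 (Subsingleton.elim _ _)
    exact this
  -- Since the homotopy vanishes, `y` is the last face of a simplex `v` whose other faces are zero.
  -- Adding `v` to `w` repairs the last face and leaves the others alone.
  obtain ⟨v, hv, hvy⟩ := hy'
  let v' : Δ[n + 1] ⟶ underlying.obj A :=
    SSet.yonedaEquiv.symm (show (underlying.obj A).obj (op ⦋n + 1⦌) from v)
  refine ⟨{ app := fun m => TypeCat.ofHom fun a => (show A.obj m from w.app m a) +
              (show A.obj m from v'.app m a)
            naturality := fun m m' f => typeHom_ext fun a => ?_ }, fun i m a ha hai => ?_⟩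
  · exact (congrArg₂ (fun s t : A.obj m' => s + t) (w.naturality_apply f a)
      (v'.naturality_apply f a)).trans (map_add (A.map f).hom _ _).symm
  obtain ⟨a', rfl⟩ := exists_comp_δ a i hai
  have hva : ∀ j, (show A.obj m from v'.app m ((SSet.stdSimplex.δ j).app m a')) =
      A.map (SSet.stdSimplex.objEquiv a').op (A.δ j v) := fun j => by
    exact A.map_comp_apply (SimplexCategory.δ j).op (SSet.stdSimplex.objEquiv a').op v
  by_cases hi : i = Fin.last _
  · subst hi
    refine (congrArg (fun t => (show A.obj m from w.app m _) + t) (hva (Fin.last _))).trans ?_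
    have e : A.δ (Fin.last (n + 1)) v = y := hvy
    rw [e]
    have hx' : (show A.obj m from x.app m ⟨_, ha⟩) =
        A.map (SSet.stdSimplex.objEquiv a').op (show A _⦋n⦌ from x.app _ ⟨d, hd⟩) :=
      x.naturality_apply (SSet.stdSimplex.objEquiv a').op ⟨d, hd⟩
    have hw' : (show A.obj m from w.app m ((SSet.stdSimplex.δ (Fin.last _)).app m a')) =
        A.map (SSet.stdSimplex.objEquiv a').op (show A _⦋n⦌ from w.app _ d) :=
      w.naturality_apply (SSet.stdSimplex.objEquiv a').op d
    refine (congrArg₂ (fun s t : A.obj m => s + t) hw' (map_sub (A.map _).hom _ _)).trans ?_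
    exact (add_sub_cancel (G := A.obj m) _ _).trans hx'.symm
  · obtain ⟨i, rfl⟩ := Fin.exists_castSucc_eq.2 hi
    refine (congrArg (fun t => (show A.obj m from w.app m _) + t) (hva _)).trans ?_
    have e : A.δ i.castSucc v = 0 := AddSubgroup.mem_iInf.1 hv i
    rw [e]
    refine (congrArg (fun t => (show A.obj m from w.app m _) + t) (map_zero (A.map _).hom)).trans ?_
    exact (add_zero (M := A.obj m) _).trans (hT _ hi m _ ha hai)

end SimplicialExtension

/-! ### Untwisting over a standard simplex -/

section Untwisting

variable {P : Type u} [Group P]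

/-- Over a standard simplex every map to `W̄P` is trivialized by the edges from the first vertex. -/
theorem WBar.exists_trivialization {n : ℕ} (b : Δ[n] ⟶ WBar P) :
    ∃ u : ∀ m, (Δ[n] : SSet.{u}).obj m → P, ∀ {m m' : SimplexCategoryᵒᵖ} (f : m ⟶ m')
      (a : (Δ[n] : SSet.{u}).obj m), u m' ((Δ[n] : SSet.{u}).map f a) =
        WBar.edge (b.app m a) (Fin.zero_le (f.unop.toOrderHom 0)) * u m a := by
  refine ⟨fun m a => WBar.edge (q := op ⦋n⦌) (SSet.yonedaEquiv b)
    (Fin.zero_le ((SSet.stdSimplex.objEquiv a).toOrderHom 0)), fun {m m'} f a => ?_⟩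
  have e : b.app m a = (WBar P).map (SSet.stdSimplex.objEquiv a).op (SSet.yonedaEquiv b) := by
    obtain ⟨y, rfl⟩ := SSet.yonedaEquiv.symm.surjective b
    rw [Equiv.apply_symm_apply]; rfl
  rw [e, WBar.edge_map, ← WBar.edge_trans]
  rfl

variable {F F' : SSet.{u}} {ρ : P →* Aut F} {ρ' : P →* Aut F'}

/-- Lifting properties against a map to a simplicial set over which all maps to `W̄P` are trivialized
pass to twisted products. -/
theorem hasLiftingProperty_twistedProduct {K L : SSet.{u}}
    (htriv : ∀ b : L ⟶ WBar P, ∃ u : ∀ m, L.obj m → P, ∀ {m m' : SimplexCategoryᵒᵖ} (f : m ⟶ m')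
      (a : L.obj m), u m' (L.map f a) =
        WBar.edge (b.app m a) (Fin.zero_le (f.unop.toOrderHom 0)) * u m a)
    (i : K ⟶ L) (m : F ⟶ F')
    [HasLiftingProperty i m] (hm : ∀ v, (ρ v).hom ≫ m = m ≫ (ρ' v).hom)
    (M : twistedProduct ρ ⟶ twistedProduct ρ')
    (hM : ∀ q (z : (twistedProduct ρ).obj q), M.app q z = (m.app q z.1, z.2)) :
    HasLiftingProperty i M := by
  refine ⟨fun {x z} sq => ?_⟩
  let b : L ⟶ WBar P :=
    { app := fun q => TypeCat.ofHom fun a => (z.app q a).2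
      naturality := fun p q f => typeHom_ext fun a => by
        have h : (z.app q (L.map f a)).2 = (WBar P).map f (z.app p a).2 :=
          congrArg Prod.snd (z.naturality_apply f a)
        exact h }
  obtain ⟨u, hu⟩ := htriv b
  have hmv : ∀ v q (c : F.obj q), m.app q ((ρ v).hom.app q c) = (ρ' v).hom.app q (m.app q c) :=
    fun v q c => congrArg (fun (t : F ⟶ F') => t.app q c) (hm v)
  have hsq : ∀ q (k : K.obj q), (m.app q (x.app q k).1, (x.app q k).2) = z.app q (i.app q k) :=
    fun q k => (hM q _).symm.trans
      (congrArg (fun (t : K ⟶ twistedProduct ρ') => t.app q k) sq.w)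
  have hxb : ∀ q (k : K.obj q), (x.app q k).2 = b.app q (i.app q k) :=
    fun q k => congrArg Prod.snd (hsq q k)
  -- Multiplying the fibre coordinate by u⁻¹ cancels the twist: by `hu`, the factor u acquires along
  -- an operator is the edge occurring in the twisted product. The square thus becomes one for the
  -- untwisted map F → F'.
  let x' : K ⟶ F :=
    { app := fun q => TypeCat.ofHom fun k => (ρ (u q (i.app q k))⁻¹).hom.app q (x.app q k).1
      naturality := fun p q f => typeHom_ext fun k => by
        have h1 : (x.app q (K.map f k)).1 = (ρ (WBar.edge (x.app p k).2 (Fin.zero_le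
          (f.unop.toOrderHom 0)))).hom.app q (F.map f (x.app p k).1) :=
          congrArg Prod.fst (x.naturality_apply f k)
        change (ρ (u q (i.app q (K.map f k)))⁻¹).hom.app q (x.app q (K.map f k)).1 =
          F.map f ((ρ (u p (i.app p k))⁻¹).hom.app p (x.app p k).1)
        rw [aut_naturality, i.naturality_apply, hu, h1, ← aut_mul_app, hxb, mul_inv_rev,
          inv_mul_cancel_right] }
  let z' : L ⟶ F' :=
    { app := fun q => TypeCat.ofHom fun a => (ρ' (u q a)⁻¹).hom.app q (z.app q a).1
      naturality := fun p q f => typeHom_ext fun a => by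
        have h1 : (z.app q (L.map f a)).1 = (ρ' (WBar.edge (b.app p a) (Fin.zero_le
          (f.unop.toOrderHom 0)))).hom.app q (F'.map f (z.app p a).1) :=
          congrArg Prod.fst (z.naturality_apply f a)
        change (ρ' (u q (L.map f a))⁻¹).hom.app q (z.app q (L.map f a)).1 =
          F'.map f ((ρ' (u p a)⁻¹).hom.app p (z.app p a).1)
        rw [aut_naturality, hu, h1, ← aut_mul_app, mul_inv_rev, inv_mul_cancel_right] }
  have sq' : CommSq x' i m z' := ⟨SSet.hom_ext fun q => typeHom_ext fun k => by
    change m.app q ((ρ (u q (i.app q k))⁻¹).hom.app q (x.app q k).1) =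
      (ρ' (u q (i.app q k))⁻¹).hom.app q (z.app q (i.app q k)).1
    rw [hmv, ← hsq]⟩
  -- The untwisted lift is multiplied by u again and paired with the base coordinate.
  refine ⟨⟨⟨{ app := fun q => TypeCat.ofHom fun a =>
                ((ρ (u q a)).hom.app q (sq'.lift.app q a), b.app q a)
              naturality := fun p q f =>
                typeHom_ext fun a => Prod.ext ?_ (b.naturality_apply f a) }, ?_, ?_⟩⟩⟩
  · change (ρ (u q (L.map f a))).hom.app q (sq'.lift.app q (L.map f a)) =
      (ρ (WBar.edge (b.app p a) (Fin.zero_le (f.unop.toOrderHom 0)))).hom.app q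
        (F.map f ((ρ (u p a)).hom.app p (sq'.lift.app p a)))
    rw [aut_naturality, ← aut_mul_app, hu, sq'.lift.naturality_apply]
  · refine SSet.hom_ext fun q => typeHom_ext fun k => Prod.ext ?_ (hxb q k).symm
    have h : sq'.lift.app q (i.app q k) = (ρ (u q (i.app q k))⁻¹).hom.app q (x.app q k).1 :=
      congrArg (fun (t : K ⟶ F) => t.app q k) sq'.fac_left
    change (ρ (u q (i.app q k))).hom.app q (sq'.lift.app q (i.app q k)) = _
    rw [h, ← aut_mul_app, mul_inv_cancel, aut_one_app]
  · refine SSet.hom_ext fun q => typeHom_ext fun a => ?_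
    refine (hM q _).trans (Prod.ext ?_ rfl)
    have h : m.app q (sq'.lift.app q a) = (ρ' (u q a)⁻¹).hom.app q (z.app q a).1 :=
      congrArg (fun (t : L ⟶ F') => t.app q a) sq'.fac_right
    change m.app q ((ρ (u q a)).hom.app q (sq'.lift.app q a)) = _
    rw [hmv, h, ← aut_mul_app, mul_inv_cancel, aut_one_app]

end Untwisting

/-! ### Lifting properties of maps of twisted products -/

section MapFibre

variable {G : Type v} [Group G] {π : (OrbitCat G)ᵒᵖ ⥤ GrpCat.{u}}
  {T T' : (OrbitCat G)ᵒᵖ ⥤ SSet.{u}}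

theorem hasLiftingProperty_mapFibre (a : OAction π T) (a' : OAction π T') (m : T ⟶ T')
    (hm : ∀ H (v : π.obj H), (a.ρ H v).hom ≫ m.app H = m.app H ≫ (a'.ρ H v).hom)
    (H : (OrbitCat G)ᵒᵖ) {K : SSet.{u}} {n : ℕ} (i : K ⟶ Δ[n])
    [HasLiftingProperty i (m.app H)] :
    HasLiftingProperty i ((OTCP.mapFibre a a' m hm).app H) :=
  hasLiftingProperty_twistedProduct WBar.exists_trivialization i (m.app H) (hm H) _
    fun _ _ => rfl

theorem rlp_I_mapFibre (a : OAction π T) (a' : OAction π T') (m : T ⟶ T')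
    (hm : ∀ H (v : π.obj H), (a.ρ H v).hom ≫ m.app H = m.app H ≫ (a'.ρ H v).hom)
    (H : (OrbitCat G)ᵒᵖ) (h : SSet.modelCategoryQuillen.I.rlp (m.app H)) :
    SSet.modelCategoryQuillen.I.rlp ((OTCP.mapFibre a a' m hm).app H) := by
  rintro _ _ _ ⟨n⟩
  have := h _ (SSet.modelCategoryQuillen.boundary_ι_mem_I n)
  exact hasLiftingProperty_mapFibre a a' m hm H _

theorem rlp_J_mapFibre (a : OAction π T) (a' : OAction π T') (m : T ⟶ T')
    (hm : ∀ H (v : π.obj H), (a.ρ H v).hom ≫ m.app H = m.app H ≫ (a'.ρ H v).hom)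
    (H : (OrbitCat G)ᵒᵖ) (h : SSet.modelCategoryQuillen.J.rlp (m.app H)) :
    SSet.modelCategoryQuillen.J.rlp ((OTCP.mapFibre a a' m hm).app H) := by
  intro _ _ i hi
  have := h _ hi
  simp only [SSet.modelCategoryQuillen.J, MorphismProperty.iSup_iff] at hi
  obtain ⟨n, ⟨k⟩⟩ := hi
  exact hasLiftingProperty_mapFibre a a' m hm H _

end MapFibre

/-! ### Gluing maps on the boundary of a simplex -/

section Boundary

theorem SimplexCategory.exists_epi_mono_factorization {m n : ℕ} (f : (⦋m⦌ : SimplexCategory) ⟶ ⦋n⦌) :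
    ∃ (r : ℕ) (e : (⦋m⦌ : SimplexCategory) ⟶ ⦋r⦌) (i : (⦋r⦌ : SimplexCategory) ⟶ ⦋n⦌),
      Epi e ∧ Mono i ∧ e ≫ i = f :=
  ⟨(Limits.image f).len, Limits.factorThruImage f, Limits.image.ι f, inferInstance, inferInstance,
    Limits.image.fac f⟩

/-- A compatible family of simplices, indexed by the operators `[r] → [N]` with `r < N`, extends
to the boundary of `Δ[N]`. -/
theorem exists_map_boundary (X : SSet.{u}) (N : ℕ)
    (c : ∀ r, ((⦋r⦌ : SimplexCategory) ⟶ ⦋N⦌) → X _⦋r⦌)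
    (hc : ∀ r r', r < N → r' < N → ∀ (α : (⦋r⦌ : SimplexCategory) ⟶ ⦋r'⦌)
      (μ : (⦋r'⦌ : SimplexCategory) ⟶ ⦋N⦌), c r (α ≫ μ) = X.map α.op (c r' μ)) :
    ∃ f : (SSet.boundary.{u} N : SSet.{u}) ⟶ X, ∀ r < N, ∀ (m : ℕ)
      (a : (SSet.boundary.{u} N : SSet.{u}) _⦋m⦌)
      (ε : (⦋m⦌ : SimplexCategory) ⟶ ⦋r⦌) (μ : (⦋r⦌ : SimplexCategory) ⟶ ⦋N⦌),
      SSet.stdSimplex.objEquiv a.1 = ε ≫ μ → f.app (op ⦋m⦌) a = X.map ε.op (c r μ) := by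
  -- The value on a boundary simplex does not depend on how its operator is factored through some
  -- [r] with r < N: each factorization is compared with the epi-mono one.
  have key : ∀ {m r₁ r₂ : ℕ} (h₁ : r₁ < N) (h₂ : r₂ < N) (ε₁ : (⦋m⦌ : SimplexCategory) ⟶ ⦋r₁⦌)
      (μ₁ : (⦋r₁⦌ : SimplexCategory) ⟶ ⦋N⦌) (ε₂ : (⦋m⦌ : SimplexCategory) ⟶ ⦋r₂⦌)
      (μ₂ : (⦋r₂⦌ : SimplexCategory) ⟶ ⦋N⦌) (_ : ε₁ ≫ μ₁ = ε₂ ≫ μ₂),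
      X.map ε₁.op (c r₁ μ₁) = X.map ε₂.op (c r₂ μ₂) := by
    intro m r₁ r₂ h₁ h₂ ε₁ μ₁ ε₂ μ₂ h
    obtain ⟨r, ε, μ, _, _, hf⟩ := SimplexCategory.exists_epi_mono_factorization (ε₁ ≫ μ₁)
    have := isSplitEpi_of_epi ε
    have aux : ∀ {r' : ℕ} (h' : r' < N) (ε' : (⦋m⦌ : SimplexCategory) ⟶ ⦋r'⦌)
        (μ' : (⦋r'⦌ : SimplexCategory) ⟶ ⦋N⦌) (_ : ε' ≫ μ' = ε ≫ μ),
        X.map ε'.op (c r' μ') = X.map ε.op (c r μ) := by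
      intro r' h' ε' μ' e
      obtain ⟨r'', ε'', μ'', _, _, rfl⟩ := SimplexCategory.exists_epi_mono_factorization μ'
      have h'' : r'' < N := (SimplexCategory.len_le_of_epi ε'').trans_lt h'
      -- A section of ε yields a comparison operator between the images. It is mono, which bounds r
      -- below N, and cancelling μ'' shows that it is compatible with the first factors.
      have e1 : (section_ ε ≫ ε' ≫ ε'') ≫ μ'' = μ := by
        simp only [Category.assoc]
        rw [e, IsSplitEpi.id_assoc]
      have e2 : ε ≫ section_ ε ≫ ε' ≫ ε'' = ε' ≫ ε'' := by
        rw [← cancel_mono μ'']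
        simp only [Category.assoc]
        rw [e, IsSplitEpi.id_assoc]
      have : Mono (section_ ε ≫ ε' ≫ ε'') := by
        have : Mono ((section_ ε ≫ ε' ≫ ε'') ≫ μ'') := by rw [e1]; infer_instance
        exact mono_of_mono _ μ''
      have hr : r < N := (SimplexCategory.len_le_of_mono (section_ ε ≫ ε' ≫ ε'')).trans_lt h''
      rw [hc _ _ h' h'', ← e1, hc _ _ hr h'']
      exact map_op_congr e2.symm _
    rw [aux h₁ _ _ hf.symm, aux h₂ _ _ (h.symm.trans hf.symm)]
  have ex : ∀ (m : ℕ) (a : (SSet.boundary.{u} N : SSet.{u}) _⦋m⦌),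
      ∃ (r : ℕ) (_ : r < N) (ε : (⦋m⦌ : SimplexCategory) ⟶ ⦋r⦌)
        (μ : (⦋r⦌ : SimplexCategory) ⟶ ⦋N⦌), SSet.stdSimplex.objEquiv a.1 = ε ≫ μ := by
    intro m a
    have ha : ¬ Function.Surjective (SSet.stdSimplex.objEquiv a.1).toOrderHom := a.2
    obtain _ | N := N
    · exact absurd (fun b => ⟨0, Subsingleton.elim (α := Fin 1) _ _⟩) ha
    · obtain ⟨i, θ, hθ⟩ := SimplexCategory.eq_comp_δ_of_not_surjective _ ha
      exact ⟨N, Nat.lt_succ_self N, θ, _, hθ⟩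
  choose r hr ε μ h using ex
  have nat : ∀ (m : SimplexCategoryᵒᵖ) (a : (SSet.boundary.{u} N : SSet.{u}).obj m) (s : ℕ)
      (_ : s < N) (ε' : m.unop ⟶ ⦋s⦌) (μ' : (⦋s⦌ : SimplexCategory) ⟶ ⦋N⦌)
      (_ : SSet.stdSimplex.objEquiv a.1 = ε' ≫ μ'),
      X.map (ε m.unop.len a).op (c _ (μ m.unop.len a)) = X.map ε'.op (c s μ') :=
    fun m a s hs ε' μ' e => key (m := m.unop.len) (hr m.unop.len a) hs _ _ _ _
      ((h m.unop.len a).symm.trans e)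
  refine ⟨{ app := fun m => TypeCat.ofHom fun a =>
              X.map (ε m.unop.len a).op (c _ (μ m.unop.len a))
            naturality := fun m m' f => typeHom_ext fun a => ?_ },
    fun s hs m a ε' μ' e => nat (op ⦋m⦌) a s hs ε' μ' e⟩
  refine (nat m' _ _ (hr m.unop.len a) (f.unop ≫ ε m.unop.len a) (μ m.unop.len a) ?_).trans ?_
  · rw [Category.assoc]
    exact congrArg (f.unop ≫ ·) (h m.unop.len a)
  · exact X.map_comp_apply (ε m.unop.len a).op f (c _ (μ m.unop.len a))

end Boundary

/-! ### Lifting from cellular diagrams through objectwise trivial fibrations -/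

namespace CellExtension

variable {C : Type*} [Category* C] {Y E E' : C ⥤ SSet.{u}}

/-- In each dimension `Y` is a coproduct of functors `C(K i, -)`. -/
structure IsCellular (Y : C ⥤ SSet.{u}) : Prop where
  existsUnique : ∀ q : ℕ, ∃ (I : Type u) (K : I → C) (y : ∀ i, (Y.obj (K i)) _⦋q⦌),
    ∀ (H : C) (x : (Y.obj H) _⦋q⦌), ∃! t : Σ i, K i ⟶ H, (Y.map t.2).app (op ⦋q⦌) (y t.1) = x
  injective : ∀ {K H : C} (g : K ⟶ H) (q : ℕ), Function.Injective ((Y.map g).app (op ⦋q⦌))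

/-- A family of functions `Y_q → E_q`. -/
abbrev Family (Y E : C ⥤ SSet.{u}) := ∀ (q : ℕ) (H : C), (Y.obj H) _⦋q⦌ → (E.obj H) _⦋q⦌

/-- The functions of the family in dimensions `< N` are compatible with all operators, and with
the morphisms of `C`. -/
structure CompatibleBelow (c : Family Y E) (N : ℕ) : Prop where
  simplicial : ∀ (q r : ℕ) (_ : q < N) (_ : r < N) (α : (⦋q⦌ : SimplexCategory) ⟶ ⦋r⦌) (H : C)
    (x : (Y.obj H) _⦋r⦌), c q H ((Y.obj H).map α.op x) = (E.obj H).map α.op (c r H x)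
  natural : ∀ (q : ℕ) (_ : q < N) {K H : C} (g : K ⟶ H) (x : (Y.obj K) _⦋q⦌),
    c q H ((Y.map g).app _ x) = (E.map g).app _ (c q K x)

variable {p : E ⟶ E'} {s : Y ⟶ E'}

/-- `e` is an admissible value at the `N`-simplex `y` for an extension of the family `c`. -/
structure Admissible (p : E ⟶ E') (s : Y ⟶ E') (c : Family Y E) (N : ℕ) (H : C)
    (y : (Y.obj H) _⦋N⦌) (e : (E.obj H) _⦋N⦌) : Prop where
  comp_eq : (p.app H).app _ e = (s.app H).app _ y
  face : ∀ (r : ℕ) (_ : r < N) (α : (⦋r⦌ : SimplexCategory) ⟶ ⦋N⦌),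
    (E.obj H).map α.op e = c r H ((Y.obj H).map α.op y)
  degen : ∀ (r : ℕ) (_ : r < N) (β : (⦋N⦌ : SimplexCategory) ⟶ ⦋r⦌) (_ : Epi β)
    (z : (Y.obj H) _⦋r⦌), (Y.obj H).map β.op z = y → e = (E.obj H).map β.op (c r H z)

/-- This makes the forced value on a degenerate simplex well defined. If i = j, a common face gives
z = w. If i < j, the simplicial identities make z and w degeneracies of one simplex v, and the claim
reduces to the identity between iterated degeneracies. -/
theorem degen_eq {c : Family Y E} {q : ℕ} (hc : CompatibleBelow c (q + 1)) {H : C}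
    (z w : (Y.obj H) _⦋q⦌) (i j : Fin (q + 1))
    (h : (Y.obj H).map (SimplexCategory.σ i).op z = (Y.obj H).map (SimplexCategory.σ j).op w) :
    (E.obj H).map (SimplexCategory.σ i).op (c q H z) =
      (E.obj H).map (SimplexCategory.σ j).op (c q H w) := by
  wlog hij : i ≤ j generalizing i j z w
  · exact (this w z j i h.symm (le_of_not_ge hij)).symm
  obtain rfl | hij := hij.eq_or_lt
  · have e : ∀ x : (Y.obj H) _⦋q⦌, (Y.obj H).map (SimplexCategory.δ i.castSucc).op
        ((Y.obj H).map (SimplexCategory.σ i).op x) = x := fun x =>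
      (map_op_congr' (SimplexCategory.δ_comp_σ_self) x).trans ((Y.obj H).map_id_apply _ x)
    rw [← e z, h, e w]
  · obtain _ | q := q
    · omega
    obtain ⟨i, rfl⟩ := Fin.exists_castSucc_eq.2 (Fin.ne_last_of_lt hij)
    obtain ⟨j, rfl⟩ := Fin.exists_succ_eq.2 (Fin.ne_zero_of_lt hij)
    have hij' : i ≤ j := Fin.castSucc_lt_succ_iff.1 hij
    -- After reindexing, the two degeneracies are `i.castSucc` and `j.succ`. The face of `z` used
    -- here is chosen so that w = σ_i v and z = σ_j v.
    obtain ⟨v, hv⟩ : ∃ v, v = (Y.obj H).map (SimplexCategory.δ j.succ).op z := ⟨_, rfl⟩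
    have hw : w = (Y.obj H).map (SimplexCategory.σ i).op v := by
      have e : w = (Y.obj H).map (SimplexCategory.δ j.succ.succ).op
          ((Y.obj H).map (SimplexCategory.σ j.succ).op w) :=
        ((map_op_congr' SimplexCategory.δ_comp_σ_succ w).trans ((Y.obj H).map_id_apply _ w)).symm
      rw [e, ← h, hv]
      exact map_op_congr (SimplexCategory.δ_comp_σ_of_gt hij) z
    have hz : z = (Y.obj H).map (SimplexCategory.σ j).op v := by
      have e : z = (Y.obj H).map (SimplexCategory.δ i.castSucc.castSucc).op
          ((Y.obj H).map (SimplexCategory.σ i.castSucc).op z) :=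
        ((map_op_congr' SimplexCategory.δ_comp_σ_self z).trans ((Y.obj H).map_id_apply _ z)).symm
      rw [e, h]
      have hij'' : i.castSucc ≤ j.castSucc := hij'
      refine (map_op_congr (SimplexCategory.δ_comp_σ_of_le hij'') w).trans ?_
      congr 1
      rw [hw]
      exact (map_op_congr' SimplexCategory.δ_comp_σ_self v).trans ((Y.obj H).map_id_apply _ v)
    clear hv
    subst hz hw
    rw [hc.simplicial _ _ (by omega) (by omega), hc.simplicial _ _ (by omega) (by omega)]
    exact map_op_congr (SimplexCategory.σ_comp_σ hij') _

/-- On a degenerate simplex the value is forced. On a nondegenerate one the values in lower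
dimensions glue to a map on ∂Δ[N], and the lifting property against ∂Δ[N] → Δ[N] supplies the value.
-/
theorem exists_admissible {c : Family Y E} {N : ℕ} (hc : CompatibleBelow c N)
    (hs : ∀ q H x, (p.app H).app _ (c q H x) = (s.app H).app _ x) {H : C}
    (hp : SSet.modelCategoryQuillen.I.rlp (p.app H)) (y : (Y.obj H) _⦋N⦌) :
    ∃ e, Admissible p s c N H y e := by
  have noninj : ∀ {q r : ℕ} (_ : r < q + 1) (β : (⦋q + 1⦌ : SimplexCategory) ⟶ ⦋r⦌),
      ∃ (k : Fin (q + 1)) (β' : (⦋q⦌ : SimplexCategory) ⟶ ⦋r⦌), β = SimplexCategory.σ k ≫ β' :=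
    fun {q r} hr β => SimplexCategory.eq_σ_comp_of_not_injective β fun hi => by
      have := SimplexCategory.mono_iff_injective.2 hi
      have := SimplexCategory.len_le_of_mono β
      simp at this
      omega
  -- It is enough to test single degeneracies, since by `noninj` an operator that lowers the
  -- dimension factors through some σ.
  by_cases hd : ∃ (q : ℕ) (h : N = q + 1) (j : Fin (q + 1)) (z : (Y.obj H) _⦋q⦌),
      (Y.obj H).map (SimplexCategory.σ j).op z = h ▸ y
  · obtain ⟨q, rfl, j, w, hw⟩ := hd
    obtain rfl : (Y.obj H).map (SimplexCategory.σ j).op w = y := hw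
    refine ⟨(E.obj H).map (SimplexCategory.σ j).op (c q H w), ?_, ?_, ?_⟩
    · rw [(p.app H).naturality_apply, (s.app H).naturality_apply, hs]
    · intro r hr α
      refine (map_op_congr' rfl _).trans (Eq.trans ?_ (congrArg _ (map_op_congr' rfl w).symm))
      exact (hc.simplicial _ _ hr (by omega) _ _ _).symm
    · intro r hr β _ z hz
      obtain ⟨k, β', rfl⟩ := noninj hr β
      have hz' : (Y.obj H).map (SimplexCategory.σ k).op ((Y.obj H).map β'.op z) =
        (Y.obj H).map (SimplexCategory.σ j).op w := (map_op_congr' rfl z).trans hz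
      refine (degen_eq hc _ _ _ _ hz'.symm).trans ?_
      rw [hc.simplicial _ _ (by omega) hr]
      exact map_op_congr' rfl _
  · obtain ⟨f, hf⟩ := exists_map_boundary (E.obj H) N
      (fun r μ => c r H ((Y.obj H).map μ.op y)) (fun r r' hr hr' α μ => by
        rw [← hc.simplicial _ _ hr hr']
        exact congrArg _ (map_op_congr' rfl y).symm)
    have hbd : ∀ {m : ℕ} (a : (SSet.boundary.{u} N : SSet.{u}) _⦋m⦌),
        ∃ (q : ℕ) (_ : q < N) (ε : (⦋m⦌ : SimplexCategory) ⟶ ⦋q⦌)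
          (μ : (⦋q⦌ : SimplexCategory) ⟶ ⦋N⦌), SSet.stdSimplex.objEquiv a.1 = ε ≫ μ := by
      intro m a
      have ha : ¬ Function.Surjective (SSet.stdSimplex.objEquiv a.1).toOrderHom := a.2
      obtain _ | N := N
      · exact absurd (fun b => ⟨0, Subsingleton.elim (α := Fin 1) _ _⟩) ha
      · obtain ⟨i, θ, hθ⟩ := SimplexCategory.eq_comp_δ_of_not_surjective _ ha
        exact ⟨N, Nat.lt_succ_self N, θ, _, hθ⟩
    have := hp _ (SSet.modelCategoryQuillen.boundary_ι_mem_I N)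
    have sq : CommSq f (SSet.boundary.{u} N).ι (p.app H)
        (SSet.yonedaEquiv.symm ((s.app H).app _ y)) := ⟨SSet.hom_ext fun m => typeHom_ext fun a => by
      induction m using Opposite.rec with | _ m =>
      induction m using SimplexCategory.rec with | _ m =>
      obtain ⟨q, hq, ε, μ, h⟩ := hbd a
      have e := hf q hq m a ε μ h
      change (p.app H).app _ (f.app _ a) =
        (E'.obj H).map (SSet.stdSimplex.objEquiv a.1).op ((s.app H).app _ y)
      rw [e, (p.app H).naturality_apply, hs, h, (s.app H).naturality_apply]
      exact map_op_congr' rfl _⟩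
    refine ⟨SSet.yonedaEquiv sq.lift, ?_, ?_, ?_⟩
    · refine (SSet.yonedaEquiv_comp _ _).symm.trans ?_
      rw [sq.fac_right, Equiv.apply_symm_apply]
    · intro r hr α
      have hα : (SSet.stdSimplex.objEquiv (m := op ⦋r⦌)).symm α ∈ (SSet.boundary.{u} N).obj _ := by
        intro hα
        have : Epi α := SimplexCategory.epi_iff_surjective.2 hα
        have : N ≤ r := SimplexCategory.len_le_of_epi α
        omega
      have e := hf r hr r ⟨_, hα⟩ (𝟙 _) α (by simp)
      have e' := congrArg (fun (t : (SSet.boundary.{u} N : SSet.{u}) ⟶ E.obj H) =>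
        t.app _ ⟨_, hα⟩) sq.fac_left
      refine Eq.trans ?_ (e'.trans (e.trans ((E.obj H).map_id_apply _ _)))
      obtain ⟨l, hl⟩ := SSet.yonedaEquiv.symm.surjective sq.lift
      rw [← hl]
      exact congrArg _ (Equiv.apply_symm_apply _ _)
    · intro r hr β _ z hz
      exfalso
      obtain _ | q := N
      · omega
      obtain ⟨k, β', rfl⟩ := noninj hr β
      exact hd ⟨q, rfl, k, (Y.obj H).map β'.op z, (map_op_congr' rfl z).trans hz⟩

/-- The point is that no new degeneracies arise along g. If g·y = β*z, a section of β writes z as g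
applied to a simplex of Y(K), and injectivity of g then makes y itself equal to β* of that simplex.
-/
theorem Admissible.map {c : Family Y E} {N : ℕ} (hc : CompatibleBelow c N) (hY : IsCellular Y)
    {K H : C} (g : K ⟶ H) {y : (Y.obj K) _⦋N⦌} {e : (E.obj K) _⦋N⦌}
    (h : Admissible p s c N K y e) :
    Admissible p s c N H ((Y.map g).app _ y) ((E.map g).app _ e) where
  comp_eq := by
    have h1 : (p.app H).app _ ((E.map g).app _ e) = (E'.map g).app _ ((p.app K).app _ e) :=
      congrArg (fun (t : E.obj K ⟶ E'.obj H) => t.app _ e) (p.naturality g)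
    have h2 : (s.app H).app _ ((Y.map g).app _ y) = (E'.map g).app _ ((s.app K).app _ y) :=
      congrArg (fun (t : Y.obj K ⟶ E'.obj H) => t.app _ y) (s.naturality g)
    rw [h1, h2, h.comp_eq]
  face r hr α := by
    rw [← (E.map g).naturality_apply, h.face r hr, ← hc.natural r hr, (Y.map g).naturality_apply]
  degen r hr β _ z hz := by
    have := isSplitEpi_of_epi β
    have hz' : z = (Y.map g).app _ ((Y.obj K).map (section_ β).op y) := by
      rw [(Y.map g).naturality_apply, ← hz]
      exact ((map_op_congr' (IsSplitEpi.id β) z).trans ((Y.obj H).map_id_apply _ z)).symm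
    have hy : (Y.obj K).map β.op ((Y.obj K).map (section_ β).op y) = y := by
      apply hY.injective g N
      rw [(Y.map g).naturality_apply, ← hz', hz]
    rw [h.degen r hr β inferInstance _ hy, (E.map g).naturality_apply, hz', hc.natural r hr]

/-- Admissible values are chosen on the generators in dimension N and transported along the
morphisms of C. Uniqueness of the generator and morphism makes the result natural, and
`Admissible.map` keeps it admissible everywhere. -/
theorem exists_next (hY : IsCellular Y) (hp : ∀ H, SSet.modelCategoryQuillen.I.rlp (p.app H))
    {c : Family Y E} {N : ℕ} (hc : CompatibleBelow c N)
    (hs : ∀ q H x, (p.app H).app _ (c q H x) = (s.app H).app _ x) :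
    ∃ c' : Family Y E, CompatibleBelow c' (N + 1) ∧
      (∀ q H x, (p.app H).app _ (c' q H x) = (s.app H).app _ x) ∧ ∀ q < N, c' q = c q := by
  obtain ⟨I, K, y, hy⟩ := hY.existsUnique N
  choose e he using fun i => exists_admissible hc hs (hp (K i)) (y i)
  choose t ht htu using hy
  let new : ∀ H : C, (Y.obj H) _⦋N⦌ → (E.obj H) _⦋N⦌ := fun H x =>
    (E.map (t H x).2).app _ (e (t H x).1)
  have hnew : ∀ H x, Admissible p s c N H x (new H x) := fun H x => by
    have h := (he (t H x).1).map hc hY (t H x).2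
    rwa [show (Y.map (t H x).2).app _ (y (t H x).1) = x from ht H x] at h
  have hnat : ∀ {K H : C} (g : K ⟶ H) x,
      new H ((Y.map g).app _ x) = (E.map g).app _ (new K x) := fun {K H} g x => by
    have h : ⟨(t K x).1, (t K x).2 ≫ g⟩ = t H ((Y.map g).app _ x) := htu _ _ _ (by
      refine (congrArg (fun (m : Y.obj _ ⟶ Y.obj H) => m.app (op ⦋N⦌) (y (t K x).1))
        (Y.map_comp (t K x).2 g)).trans ?_
      exact congrArg ((Y.map g).app (op ⦋N⦌)) (ht K x))
    refine (congrArg (fun z : Σ i, _ ⟶ H => (E.map z.2).app (op ⦋N⦌) (e z.1)) h.symm).trans ?_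
    exact congrArg (fun (m : E.obj _ ⟶ E.obj H) => m.app (op ⦋N⦌) (e (t K x).1))
        (E.map_comp (t K x).2 g)
  have hself : Function.update c N new N = new := Function.update_self _ _ _
  have hlt : ∀ q < N, Function.update c N new q = c q := fun q hq =>
    Function.update_of_ne hq.ne _ _
  refine ⟨Function.update c N new, ⟨fun q r hq hr α H x => ?_, fun q hq K H g x => ?_⟩,
    fun q H x => ?_, hlt⟩
  · obtain hq | rfl := Nat.lt_succ_iff_lt_or_eq.1 hq
    · obtain hr | rfl := Nat.lt_succ_iff_lt_or_eq.1 hr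
      · rw [hlt q hq, hlt r hr, hc.simplicial q r hq hr]
      · rw [hlt q hq, hself, (hnew H x).face q hq]
    -- The degeneracy condition handles the epi part, while compatibility below N or the face
    -- condition handles the mono part. If the image has full dimension, both parts are identities.
    · obtain ⟨a, ε, μ, _, _, rfl⟩ := SimplexCategory.exists_epi_mono_factorization α
      have key : a < q → new H ((Y.obj H).map (ε ≫ μ).op x) =
          (E.obj H).map ε.op (c a H ((Y.obj H).map μ.op x)) := fun ha =>
        (hnew H _).degen a ha ε inferInstance _ (map_op_congr' rfl x)
      obtain hr | rfl := Nat.lt_succ_iff_lt_or_eq.1 hr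
      · have ha : a ≤ r := SimplexCategory.len_le_of_mono μ
        rw [hself, hlt r hr, key (by omega), hc.simplicial a r (by omega) hr]
        exact map_op_congr' rfl _
      · have ha : a ≤ r := SimplexCategory.len_le_of_mono μ
        rw [hself]
        obtain ha | rfl := ha.lt_or_eq
        · rw [key ha, ← (hnew H x).face a ha]
          exact map_op_congr' rfl _
        · obtain rfl := SimplexCategory.eq_id_of_mono μ
          obtain rfl := SimplexCategory.eq_id_of_epi ε
          rw [Category.comp_id]
          exact (congrArg (new H) ((Y.obj H).map_id_apply _ x)).trans
            ((E.obj H).map_id_apply _ _).symm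
  · obtain hq | rfl := Nat.lt_succ_iff_lt_or_eq.1 hq
    · rw [hlt q hq, hc.natural q hq]
    · rw [hself, hnat]
  · obtain rfl | hq := eq_or_ne q N
    · rw [hself]
      exact (hnew H x).comp_eq
    · rw [Function.update_of_ne hq, hs]

/-- Lifting against boundary inclusions gives lifting against all monomorphisms, in particular
against ∅ → Δ[q]. -/
theorem surjective_of_rlp_I {A Z : SSet.{u}} (f : A ⟶ Z)
    (hf : SSet.modelCategoryQuillen.I.rlp f) (q : ℕ) : Function.Surjective (f.app (op ⦋q⦌)) := by
  intro z
  have hf' : (MorphismProperty.monomorphisms SSet.{u}).rlp f := SSet.rlp_monomorphisms.{u} ▸ hf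
  have := hf' (⊥ : (Δ[q] : SSet.{u}).Subcomplex).ι (MorphismProperty.monomorphisms.infer_property _)
  have sq : CommSq (SSet.Subcomplex.isInitialBot.to A) (⊥ : (Δ[q] : SSet.{u}).Subcomplex).ι f
    (SSet.yonedaEquiv.symm z) := ⟨SSet.Subcomplex.isInitialBot.hom_ext _ _⟩
  refine ⟨SSet.yonedaEquiv sq.lift, ?_⟩
  refine (SSet.yonedaEquiv_comp _ _).symm.trans ?_
  rw [sq.fac_right, Equiv.apply_symm_apply]

/-- A morphism of diagrams of simplicial sets which is objectwise a trivial fibration has the right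
lifting property with respect to `∅ → Y` if `Y` is cellular. -/
theorem exists_lift (hY : IsCellular Y) (hp : ∀ H, SSet.modelCategoryQuillen.I.rlp (p.app H)) :
    ∃ t : Y ⟶ E, t ≫ p = s := by
  -- The induction starts from arbitrary pointwise preimages: compatibility below 0 is vacuous, and
  -- dimension N is overwritten at stage N + 1.
  choose c₀ hc₀ using fun q H x => surjective_of_rlp_I (p.app H) (hp H) q ((s.app H).app _ x)
  let S (N : ℕ) := { c : Family Y E // CompatibleBelow c N ∧
    ∀ q H x, (p.app H).app _ (c q H x) = (s.app H).app _ x }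
  let next (N : ℕ) (c : S N) : S (N + 1) :=
    ⟨(exists_next hY hp c.2.1 c.2.2).choose, (exists_next hY hp c.2.1 c.2.2).choose_spec.1,
      (exists_next hY hp c.2.1 c.2.2).choose_spec.2.1⟩
  have hnext : ∀ (N : ℕ) (c : S N), ∀ q < N, (next N c).1 q = c.1 q := fun N c =>
    (exists_next hY hp c.2.1 c.2.2).choose_spec.2.2
  let F : ∀ N, S N := fun N => Nat.rec (motive := S)
    ⟨c₀, ⟨fun q _ hq => absurd hq (Nat.not_lt_zero q), fun q hq => absurd hq (Nat.not_lt_zero q)⟩,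
      hc₀⟩ next N
  have hF : ∀ N q, q < N → (F N).1 q = (F (q + 1)).1 q := by
    intro N q h
    induction N, Nat.succ_le_of_lt h using Nat.le_induction with
    | base => rfl
    | succ N hN ih => exact (hnext N (F N) q hN).trans (ih hN)
  -- Dimension q is final from stage q + 1 on, so the diagonal family is compatible in all
  -- dimensions.
  refine ⟨{ app := fun H =>
              { app := fun q => TypeCat.ofHom ((F (q.unop.len + 1)).1 q.unop.len H)
                naturality := fun q r α => typeHom_ext fun x => ?_ }
            naturality := fun K H g => SSet.hom_ext fun q => typeHom_ext fun x => ?_ },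
    NatTrans.ext (funext fun H => SSet.hom_ext fun q => typeHom_ext fun x => ?_)⟩
  · obtain ⟨N, hN, hN'⟩ : ∃ N, q.unop.len < N ∧ r.unop.len < N :=
      ⟨max q.unop.len r.unop.len + 1, by omega, by omega⟩
    have h := (F N).2.1.simplicial _ _ hN' hN α.unop H x
    rw [hF N _ hN, hF N _ hN'] at h
    exact h
  · exact (F (q.unop.len + 1)).2.1.natural _ (Nat.lt_succ_self _) g x
  · exact (F (q.unop.len + 1)).2.2 _ H x

/-- Currying of a morphism of diagrams `Y ⊗ L ⟶ E`. -/
noncomputable def curryTensor {L : SSet.{u}} (b : Y ⋙ tensorRight L ⟶ E) : Y ⟶ E ⋙ ihom L where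
  app H := MonoidalClosed.curry ((β_ L (Y.obj H)).hom ≫ b.app H)
  naturality K H g := by
    have h : Y.map g ▷ L ≫ b.app H = b.app K ≫ E.map g := b.naturality g
    change Y.map g ≫ MonoidalClosed.curry _ = MonoidalClosed.curry _ ≫ (ihom L).map (E.map g)
    rw [← MonoidalClosed.curry_natural_left, ← MonoidalClosed.curry_natural_right, Category.assoc,
      ← h, BraidedCategory.braiding_naturality_right_assoc]

/-- The inverse of `curryTensor`. -/
noncomputable def uncurryTensor {L : SSet.{u}} (t : Y ⟶ E ⋙ ihom L) : Y ⋙ tensorRight L ⟶ E where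
  app H := (β_ (Y.obj H) L).hom ≫ MonoidalClosed.uncurry (t.app H)
  naturality K H g := by
    have h : Y.map g ≫ t.app H = t.app K ≫ (ihom L).map (E.map g) := t.naturality g
    change Y.map g ▷ L ≫ (β_ (Y.obj H) L).hom ≫ _ = (_ ≫ MonoidalClosed.uncurry _) ≫ E.map g
    rw [Category.assoc, ← MonoidalClosed.uncurry_natural_right, ← h,
      MonoidalClosed.uncurry_natural_left, BraidedCategory.braiding_naturality_left_assoc]

/-- A square from `Y ⊗ i` to `p` has a lift if `Y` is cellular and the Leibniz power of `p` by `i`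
is objectwise a trivial fibration. -/
theorem exists_lift_tensor (hY : IsCellular Y) {K L : SSet.{u}} (i : K ⟶ L) (p : E ⟶ E')
    (h : ∀ H (sq : MonoidalClosed.internalHom.PullbackObjObj i (p.app H)),
      SSet.modelCategoryQuillen.I.rlp sq.π)
    (a : Y ⋙ tensorRight K ⟶ E) (b : Y ⋙ tensorRight L ⟶ E')
    (w : ∀ H, Y.obj H ◁ i ≫ b.app H = a.app H ≫ p.app H) :
    ∃ t : Y ⋙ tensorRight L ⟶ E, (∀ H, Y.obj H ◁ i ≫ t.app H = a.app H) ∧ t ≫ p = b := by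
  let f : E ⋙ ihom K ⟶ E' ⋙ ihom K := Functor.whiskerRight p (ihom K)
  let g : E' ⋙ ihom L ⟶ E' ⋙ ihom K := Functor.whiskerLeft E' (MonoidalClosed.pre i)
  let π : E ⋙ ihom L ⟶ Limits.pullback f g := Limits.pullback.lift
    (Functor.whiskerLeft E (MonoidalClosed.pre i)) (Functor.whiskerRight p (ihom L)) (by
      ext1; ext1 H
      exact MonoidalClosed.pre_comm_ihom_map i (p.app H))
  -- Pullbacks of diagrams are computed objectwise, so each component of π is the Leibniz power of
  -- the corresponding component of p.
  have hπ : ∀ H, SSet.modelCategoryQuillen.I.rlp (π.app H) := fun H =>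
    h H
      { pt := (Limits.pullback f g).obj H
        fst := (Limits.pullback.fst f g).app H
        snd := (Limits.pullback.snd f g).app H
        isPullback := (IsPullback.of_hasPullback f g).map ((evaluation C SSet.{u}).obj H)
        π := π.app H
        π_fst := congrArg (fun t => t.app H) (Limits.pullback.lift_fst _ _ _ : π ≫ _ = _)
        π_snd := congrArg (fun t => t.app H) (Limits.pullback.lift_snd _ _ _ : π ≫ _ = _) }
  let s : Y ⟶ Limits.pullback f g := Limits.pullback.lift (curryTensor a) (curryTensor b) (by
    ext1; ext1 H
    change MonoidalClosed.curry _ ≫ (ihom K).map (p.app H) =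
      MonoidalClosed.curry _ ≫ (MonoidalClosed.pre i).app (E'.obj H)
    rw [← MonoidalClosed.curry_natural_right, MonoidalClosed.curry_pre_app, Category.assoc, ← w,
      BraidedCategory.braiding_naturality_left_assoc])
  obtain ⟨t, ht⟩ := exists_lift (s := s) hY hπ
  have e₁ : π ≫ Limits.pullback.fst f g = _ := Limits.pullback.lift_fst _ _ _
  have e₂ : π ≫ Limits.pullback.snd f g = _ := Limits.pullback.lift_snd _ _ _
  have e₃ : s ≫ Limits.pullback.fst f g = _ := Limits.pullback.lift_fst _ _ _
  have e₄ : s ≫ Limits.pullback.snd f g = _ := Limits.pullback.lift_snd _ _ _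
  have h₁ : ∀ H, t.app H ≫ (MonoidalClosed.pre i).app (E.obj H) = (curryTensor a).app H := fun H =>
    congrArg (fun z => z.app H) (show t ≫ Functor.whiskerLeft E (MonoidalClosed.pre i) = _ by
      rw [← e₁, ← e₃, ← ht, Category.assoc])
  have h₂ : ∀ H, t.app H ≫ (ihom L).map (p.app H) = (curryTensor b).app H := fun H =>
    congrArg (fun z => z.app H) (show t ≫ Functor.whiskerRight p (ihom L) = _ by
      rw [← e₂, ← e₄, ← ht, Category.assoc])
  refine ⟨uncurryTensor t, fun H => ?_, NatTrans.ext (funext fun H => ?_)⟩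
  · change Y.obj H ◁ i ≫ (β_ (Y.obj H) L).hom ≫ _ = _
    rw [BraidedCategory.braiding_naturality_right_assoc, ← MonoidalClosed.uncurry_pre_app, h₁]
    change _ ≫ MonoidalClosed.uncurry (MonoidalClosed.curry _) = _
    rw [MonoidalClosed.uncurry_curry, SymmetricCategory.symmetry_assoc]
  · change (_ ≫ MonoidalClosed.uncurry _) ≫ p.app H = _
    rw [Category.assoc, ← MonoidalClosed.uncurry_natural_right, h₂]
    change _ ≫ MonoidalClosed.uncurry (MonoidalClosed.curry _) = _
    rw [MonoidalClosed.uncurry_curry, SymmetricCategory.symmetry_assoc]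

/-- By adjunction, a lifting problem of ∂Δ[n] → Δ[n] against the Leibniz power of p is one of the
pushout-product of K ⊆ L with ∂Δ[n] ⊆ Δ[n] against p. -/
theorem rlp_I_of_unionProd {L : SSet.{u}} (K : L.Subcomplex) {A Z : SSet.{u}} (p : A ⟶ Z)
    (h : ∀ n, HasLiftingProperty (K.unionProd (SSet.boundary.{u} n)).ι p)
    (sq : MonoidalClosed.internalHom.PullbackObjObj K.ι p) :
    SSet.modelCategoryQuillen.I.rlp sq.π := by
  rintro _ _ _ ⟨n⟩
  rw [← MonoidalClosed.internalHomAdjunction₂.hasLiftingProperty_iff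
    (SSet.Subcomplex.unionProd.pushoutObjObj.{u} K (SSet.boundary.{u} n))]
  exact h n

/-- Extension of lifts along a monomorphism, for an objectwise trivial fibration. -/
theorem exists_lift_tensor_of_rlp_I (hY : IsCellular Y) {L : SSet.{u}} (K : L.Subcomplex)
    (p : E ⟶ E') (hp : ∀ H, SSet.modelCategoryQuillen.I.rlp (p.app H))
    (a : Y ⋙ tensorRight (K : SSet.{u}) ⟶ E) (b : Y ⋙ tensorRight L ⟶ E')
    (w : ∀ H, Y.obj H ◁ K.ι ≫ b.app H = a.app H ≫ p.app H) :
    ∃ t : Y ⋙ tensorRight L ⟶ E, (∀ H, Y.obj H ◁ K.ι ≫ t.app H = a.app H) ∧ t ≫ p = b :=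
  exists_lift_tensor hY K.ι p (fun H => rlp_I_of_unionProd K (p.app H) fun n => by
    have h : (MorphismProperty.monomorphisms SSet.{u}).rlp (p.app H) :=
      SSet.rlp_monomorphisms.{u} ▸ hp H
    exact h _ (MorphismProperty.monomorphisms.infer_property _)) a b w

/-- Extension of lifts along an anodyne extension, for an objectwise Kan fibration. -/
theorem exists_lift_tensor_of_rlp_J (hY : IsCellular Y) {L : SSet.{u}} (K : L.Subcomplex)
    (hK : SSet.anodyneExtensions K.ι)
    (p : E ⟶ E') (hp : ∀ H, SSet.modelCategoryQuillen.J.rlp (p.app H))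
    (a : Y ⋙ tensorRight (K : SSet.{u}) ⟶ E) (b : Y ⋙ tensorRight L ⟶ E')
    (w : ∀ H, Y.obj H ◁ K.ι ≫ b.app H = a.app H ≫ p.app H) :
    ∃ t : Y ⋙ tensorRight L ⟶ E, (∀ H, Y.obj H ◁ K.ι ≫ t.app H = a.app H) ∧ t ≫ p = b :=
  exists_lift_tensor hY K.ι p (fun H => rlp_I_of_unionProd K (p.app H) fun _ =>
    SSet.anodyneExtensions_unionProd_ι' K _ hK _ (hp H)) a b w

end CellExtension

/-! ### Fixed point diagrams are cellular -/

section Phi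

variable {G : Type v} [Group G]

theorem gact_injective (X : Action SSet.{u} G) (q : SimplexCategoryᵒᵖ) (g : G) :
    Function.Injective (gact X q g) := fun x y h => by
  have h' := congrArg (gact X q g⁻¹) h
  rwa [← gact_mul, ← gact_mul, inv_mul_cancel, gact_one, gact_one] at h'

theorem OrbitCat.map_mk {H K : OrbitCat G} (φ : H ⟶ K) (g : G) :
    (show (G ⧸ H.sub) →[G] (G ⧸ K.sub) from φ) (QuotientGroup.mk g) =
      g • (show (G ⧸ H.sub) →[G] (G ⧸ K.sub) from φ) (QuotientGroup.mk 1) := by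
  rw [← map_smul, MulAction.Quotient.smul_mk, smul_eq_mul, mul_one]

/-- The `O_G`-simplicial set `ΦX` is cellular: its `q`-simplices are the coproduct of the functors
represented by the orbits of `G` on `X_q`. -/
theorem isCellular_Phi (X : Action SSet.{u} G) : CellExtension.IsCellular (Phi X) where
  injective {K H} g q x y h := by
    have h' : orbitPoint X x ((show (G ⧸ H.unop.sub) →[G] (G ⧸ K.unop.sub) from g.unop)
        (QuotientGroup.mk 1)) = orbitPoint X y ((show (G ⧸ H.unop.sub) →[G] (G ⧸ K.unop.sub)
          from g.unop) (QuotientGroup.mk 1)) := congrArg Subtype.val h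
    revert h'
    generalize (show (G ⧸ H.unop.sub) →[G] (G ⧸ K.unop.sub) from g.unop) (QuotientGroup.mk 1) = c
    induction c using QuotientGroup.induction_on with
    | H a => exact fun h' => Subtype.ext (gact_injective X _ a h')
  existsUnique q := by
    let Q : SimplexCategoryᵒᵖ := op ⦋q⦌
    let S : Setoid (X.V.obj Q) :=
      { r := fun x y => ∃ g, gact X Q g x = y
        iseqv :=
          { refl := fun x => ⟨1, gact_one X Q x⟩
            symm := by
              rintro x _ ⟨g, rfl⟩
              exact ⟨g⁻¹, by rw [← gact_mul, inv_mul_cancel, gact_one]⟩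
            trans := by
              rintro x _ _ ⟨g, rfl⟩ ⟨h, rfl⟩
              exact ⟨h * g, gact_mul X Q h g x⟩ } }
    let rep : Quotient S → X.V.obj Q := Quotient.out
    let stab : X.V.obj Q → Subgroup G := fun x =>
      { carrier := {g | gact X Q g x = x}
        one_mem' := gact_one X Q x
        mul_mem' := fun {a b} ha hb => (gact_mul X Q a b x).trans ((congrArg _ hb).trans ha)
        inv_mem' := fun {a} ha => gact_injective X Q a (by
          rw [← gact_mul, mul_inv_cancel, gact_one]; exact Eq.symm ha) }
    refine ⟨Quotient S, fun i => op ⟨stab (rep i)⟩, fun i => ⟨rep i, fun h hh => hh⟩,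
      fun H x => ?_⟩
    -- If x = a·rep is fixed by H, then bH ↦ ba·Stab(rep) is a well-defined G-map G/H → G/Stab(rep),
    -- and it carries the generator to x.
    obtain ⟨a, ha⟩ : ∃ a, gact X Q a (rep (Quotient.mk S x.1)) = x.1 := Quotient.mk_out x.1
    have hrep : ∀ (i : Quotient S) (b c : G), gact X Q b (rep i) = gact X Q c (rep i) →
        (QuotientGroup.mk b : G ⧸ stab (rep i)) = QuotientGroup.mk c := fun i b c h => by
      rw [QuotientGroup.eq]
      change gact X Q (b⁻¹ * c) (rep i) = rep i
      rw [gact_mul, ← h, ← gact_mul, inv_mul_cancel, gact_one]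
    let φ : (G ⧸ H.unop.sub) →[G] (G ⧸ stab (rep (Quotient.mk S x.1))) :=
      { toFun := fun c => Quotient.liftOn' c (fun b => QuotientGroup.mk (b * a)) (fun b c h => by
          rw [QuotientGroup.leftRel_apply] at h
          apply hrep
          have hx : gact X Q (b⁻¹ * c) x.1 = x.1 := x.2 _ h
          rw [gact_mul, gact_mul, ha]
          nth_rewrite 1 [← hx]
          rw [← gact_mul, mul_inv_cancel_left])
        map_smul' := fun g c => by
          induction c using QuotientGroup.induction_on with
          | H b => exact congrArg QuotientGroup.mk (mul_assoc g b a) }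
    refine ⟨⟨Quotient.mk S x.1, Quiver.Hom.op (X := H.unop) φ⟩, ?_, ?_⟩
    · apply Subtype.ext
      change gact X Q (1 * a) (rep _) = x.1
      rw [one_mul, ha]
    -- The orbit of x determines i. A G-map is determined by its value at eH, and a coset of the
    -- stabilizer by where it sends the representative.
    · rintro ⟨i, ψ⟩ hψ
      have hψ' : orbitPoint X (K := stab (rep i)) ⟨rep i, fun h hh => hh⟩
        ((show (G ⧸ H.unop.sub) →[G] (G ⧸ stab (rep i)) from ψ.unop) (QuotientGroup.mk 1)) = x.1 :=
        congrArg Subtype.val hψ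
      obtain ⟨b, hb⟩ := QuotientGroup.mk_surjective
        ((show (G ⧸ H.unop.sub) →[G] (G ⧸ stab (rep i)) from ψ.unop) (QuotientGroup.mk 1))
      rw [← hb] at hψ'
      replace hψ' : gact X Q b (rep i) = x.1 := hψ'
      obtain rfl : i = Quotient.mk S x.1 :=
        (Quotient.out_eq i).symm.trans (Quotient.sound ⟨b, hψ'⟩)
      refine congrArg (Sigma.mk _) (Quiver.Hom.unop_inj (DFunLike.ext
        (F := (G ⧸ H.unop.sub) →[G] (G ⧸ stab (rep (Quotient.mk S x.1)))) _ _ fun c => ?_))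
      induction c using QuotientGroup.induction_on with
      | H c =>
        refine (OrbitCat.map_mk ψ.unop c).trans ?_
        rw [← hb]
        exact hrep _ _ _ (by
          refine (gact_mul X Q c b _).trans ((congrArg _ ?_).trans (gact_mul X Q c a _).symm)
          exact hψ'.trans ha.symm)

end Phi

/-! ### Cylinders and their ends -/

section Tensor

variable {C : Type*} [Category* C] (Y : C ⥤ SSet.{u})

/-- The projection `Y ⊗ L ⟶ Y`. -/
noncomputable def tensorFst (L : SSet.{u}) : Y ⋙ tensorRight L ⟶ Y where
  app H := SemiCartesianMonoidalCategory.fst (Y.obj H) L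
  naturality _ _ _ := rfl

/-- The map `Y ⊗ K ⟶ Y ⊗ L` induced by `i : K ⟶ L`. -/
noncomputable def tensorMap {K L : SSet.{u}} (i : K ⟶ L) :
    Y ⋙ tensorRight K ⟶ Y ⋙ tensorRight L where
  app H := Y.obj H ◁ i
  naturality _ _ _ := rfl

/-- The inclusion of the end `0` of the cylinder. -/
noncomputable def cylinderZero : Y ⟶ Y ⋙ tensorRight (Δ[1] : SSet.{u}) where
  app _ := SSet.ι₀
  naturality _ _ _ := rfl

/-- The inclusion of the end `1` of the cylinder. -/
noncomputable def cylinderOne : Y ⟶ Y ⋙ tensorRight (Δ[1] : SSet.{u}) where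
  app _ := SSet.ι₁
  naturality _ _ _ := rfl

theorem ι₀_app_eq (X : SSet.{u}) {q : SimplexCategoryᵒᵖ} (x : X.obj q)
    (k : (Δ[1] : SSet.{u}).obj q) (h : ∀ i, (SSet.stdSimplex.objEquiv k).toOrderHom i = 0) :
    (SSet.ι₀ : X ⟶ X ⊗ Δ[1]).app q x = (x, k) :=
  Prod.ext rfl (SSet.stdSimplex.objEquiv.injective
    (SimplexCategory.Hom.ext _ _ (OrderHom.ext _ _ (funext fun i => (h i).symm))))

theorem eq_zero_of_mem_horn {q : SimplexCategoryᵒᵖ} (k : (Δ[1] : SSet.{u}).obj q)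
    (hk : k ∈ (SSet.horn.{u} 1 0).obj q) (i : Fin (q.unop.len + 1)) :
    (SSet.stdSimplex.objEquiv k).toOrderHom i = 0 := by
  by_contra h
  refine hk (Set.eq_univ_of_forall fun j => ?_)
  obtain rfl | hj := eq_or_ne j 0
  · exact Or.inr rfl
  · exact Or.inl ⟨i, (Fin.eq_one_of_ne_zero _ h).trans (Fin.eq_one_of_ne_zero _ hj).symm⟩

theorem eq_of_mem_boundary {q : SimplexCategoryᵒᵖ} (k : (Δ[1] : SSet.{u}).obj q)
    (hk : k ∈ (SSet.boundary.{u} 1).obj q) (i j : Fin (q.unop.len + 1)) :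
    (SSet.stdSimplex.objEquiv k).toOrderHom i = (SSet.stdSimplex.objEquiv k).toOrderHom j := by
  by_contra h
  refine hk fun l => ?_
  by_cases hl : (SSet.stdSimplex.objEquiv k).toOrderHom i = l
  · exact ⟨i, hl⟩
  · exact ⟨j, by
      revert h hl
      generalize (SSet.stdSimplex.objEquiv k).toOrderHom i = a
      change ¬ a = (SSet.stdSimplex.objEquiv k).toOrderHom j → ¬ a = l →
        (SSet.stdSimplex.objEquiv k).toOrderHom j = l
      generalize (SSet.stdSimplex.objEquiv k).toOrderHom j = b
      revert a b l
      decide⟩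

end Tensor

/-! ### Extending lifts over cylinders -/

namespace Lifts

variable {G : Type v} [Group G] {π : (OrbitCat G)ᵒᵖ ⥤ GrpCat.{u}}

variable {B B' Y : (OrbitCat G)ᵒᵖ ⥤ SSet.{u}}
  {T T' : (OrbitCat G)ᵒᵖ ⥤ SimplicialObject AddCommGrpCat.{u}}
  {a : OAction π T} {a' : OAction π T'}

/-- Precomposition of lifts. -/
def comap (j : B' ⟶ B) {θ : B ⟶ OWBar π} {θ' : B' ⟶ OWBar π} (h : j ≫ θ = θ') :
    Lifts (a.comp underlying) θ →+ Lifts (a.comp underlying) θ' where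
  toFun f := ⟨j ≫ f.1, by rw [Category.assoc, f.2, h]⟩
  map_zero' := ext_coeff fun _ _ _ => rfl
  map_add' _ _ := ext_coeff fun _ _ _ => rfl

theorem coeff_sub {θ : B ⟶ OWBar π} (f f' : Lifts (a.comp underlying) θ) (H : (OrbitCat G)ᵒᵖ)
    (q : SimplexCategoryᵒᵖ) (x : (B.obj H).obj q) :
    (f - f').coeff H q x = f.coeff H q x - f'.coeff H q x := by
  rw [sub_eq_add_neg, sub_eq_add_neg, coeff_add, coeff_neg]

variable {θ : Y ⟶ OWBar π}

/-- Restriction of a lift to the end `0` of the cylinder. -/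
noncomputable def endZero :
    Lifts (a.comp underlying) (tensorFst Y Δ[1] ≫ θ) →+ Lifts (a.comp underlying) θ :=
  comap (cylinderZero Y) rfl

/-- Restriction of a lift to the end `1` of the cylinder. -/
noncomputable def endOne :
    Lifts (a.comp underlying) (tensorFst Y Δ[1] ≫ θ) →+ Lifts (a.comp underlying) θ :=
  comap (cylinderOne Y) rfl

/-- The constant lift over the cylinder. -/
noncomputable def cylinder :
    Lifts (a.comp underlying) θ →+ Lifts (a.comp underlying) (tensorFst Y Δ[1] ≫ θ) :=
  comap (tensorFst Y Δ[1]) rfl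

theorem endZero_cylinder (f : Lifts (a.comp underlying) θ) : endZero (cylinder f) = f := rfl

theorem endOne_cylinder (f : Lifts (a.comp underlying) θ) : endOne (cylinder f) = f := rfl

theorem endZero_push (m : T ⟶ T')
    (hm : ∀ H (v : π.obj H), (a.ρ H v).hom ≫ m.app H = m.app H ≫ (a'.ρ H v).hom)
    (f : Lifts (a.comp underlying) (tensorFst Y Δ[1] ≫ θ)) :
    endZero (push m hm f) = push m hm (endZero f) := rfl

theorem endOne_push (m : T ⟶ T')
    (hm : ∀ H (v : π.obj H), (a.ρ H v).hom ≫ m.app H = m.app H ≫ (a'.ρ H v).hom)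
    (f : Lifts (a.comp underlying) (tensorFst Y Δ[1] ≫ θ)) :
    endOne (push m hm f) = push m hm (endOne f) := rfl

/-- A vertical homotopy is a lift over the cylinder. -/
theorem vertHomotopic_iff (f f' : Lifts (a.comp underlying) θ) :
    VertHomotopic f f' ↔ ∃ F : Lifts (a.comp underlying) (tensorFst Y Δ[1] ≫ θ),
      endZero F = f ∧ endOne F = f' := by
  constructor
  · rintro ⟨F, hF⟩
    exact ⟨⟨F, NatTrans.ext (funext fun H => (hF H).2.2)⟩,
      Subtype.ext (NatTrans.ext (funext fun H => (hF H).1)),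
      Subtype.ext (NatTrans.ext (funext fun H => (hF H).2.1))⟩
  · rintro ⟨F, rfl, rfl⟩
    exact ⟨F.1, fun H => ⟨rfl, rfl, congrArg (fun t => t.app H) F.2⟩⟩

/-- The map (c, b) ↦ (m c, b) of twisted products is an objectwise Kan fibration if m is surjective,
and an objectwise trivial fibration if m is one. The extension found over it covers θ automatically,
because its image `b` does. -/
theorem exists_extension (hY : CellExtension.IsCellular Y) {L : SSet.{u}} (K : L.Subcomplex)
    (m : T ⟶ T') (hm : ∀ H (v : π.obj H), (a.ρ H v).hom ≫ m.app H = m.app H ≫ (a'.ρ H v).hom)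
    (h : SSet.anodyneExtensions K.ι ∧ (∀ H q, Function.Surjective ((m.app H).app q)) ∨
      ∀ H, SSet.modelCategoryQuillen.I.rlp (underlying.map (m.app H)))
    (c : Lifts (a.comp underlying) (tensorFst Y (K : SSet.{u}) ≫ θ))
    (b : Lifts (a'.comp underlying) (tensorFst Y L ≫ θ))
    (w : push m hm c = comap (tensorMap Y K.ι) rfl b) :
    ∃ t : Lifts (a.comp underlying) (tensorFst Y L ≫ θ),
      comap (tensorMap Y K.ι) rfl t = c ∧ push m hm t = b := by
  let M := OTCP.mapFibre (a.comp underlying) (a'.comp underlying)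
    (Functor.whiskerRight m underlying) (fun H v => congrArg underlying.map (hm H v))
  have w' : ∀ H, Y.obj H ◁ K.ι ≫ b.1.app H = c.1.app H ≫ M.app H := fun H =>
    (congrArg (fun z => z.1.app H) w).symm
  obtain ⟨t, ht₁, ht₂⟩ : ∃ t : Y ⋙ tensorRight L ⟶ OTCP (a.comp underlying),
      (∀ H, Y.obj H ◁ K.ι ≫ t.app H = c.1.app H) ∧ t ≫ M = b.1 := by
    obtain ⟨hK, h⟩ | h := h
    · exact CellExtension.exists_lift_tensor_of_rlp_J hY K hK M (fun H =>
        rlp_J_mapFibre _ _ _ _ H (SimplicialExtension.rlp_J_of_surjective _ (h H))) _ _ w'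
    · exact CellExtension.exists_lift_tensor_of_rlp_I hY K M (fun H =>
        rlp_I_mapFibre _ _ _ _ H (h H)) _ _ w'
  refine ⟨⟨t, ?_⟩, Subtype.ext (NatTrans.ext (funext ht₁)), Subtype.ext ht₂⟩
  rw [← b.2, ← ht₂, Category.assoc]
  rfl

/-- Lifts to a twisted product with acyclic fibre extend along monomorphisms. -/
theorem exists_extension_of_acyclic (hY : CellExtension.IsCellular Y) {L : SSet.{u}}
    (K : L.Subcomplex) (hT : ∀ H n, Subsingleton (homotopyGroup (T.obj H) n))
    (c : Lifts (a.comp underlying) (tensorFst Y (K : SSet.{u}) ≫ θ)) :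
    ∃ t : Lifts (a.comp underlying) (tensorFst Y L ≫ θ), comap (tensorMap Y K.ι) rfl t = c := by
  -- With the zero group as target, the condition on m says that the fibre is a contractible Kan
  -- complex.
  let Z : (OrbitCat G)ᵒᵖ ⥤ SimplicialObject AddCommGrpCat.{u} :=
    (Functor.const _).obj ((SimplicialObject.const _).obj (AddCommGrpCat.of PUnit))
  have hZ : ∀ H q, Subsingleton ((Z.obj H).obj q) := fun _ _ => inferInstanceAs (Subsingleton PUnit)
  let aZ : OAction π Z := ⟨fun _ => 1, fun _ _ => rfl⟩
  obtain ⟨t, ht, -⟩ := exists_extension (a' := aZ) hY K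
    { app := fun H => { app := fun q => 0, naturality := fun _ _ _ => by simp }
      naturality := fun _ _ _ => by ext : 2; simp }
    (fun _ _ => by ext : 2; rfl)
    (Or.inr fun H => SimplicialExtension.rlp_I_of_acyclic _ (hT H)) c 0
    (ext_coeff fun H q _ => (hZ H q).elim _ _)
  exact ⟨t, ht⟩

end Lifts

/-! ### Vertical homotopy compared with coboundaries -/

namespace CartanTheory

section VerticalHomotopy

variable {G : Type v} [Group G] {π : (OrbitCat G)ᵒᵖ ⥤ GrpCat.{u}}
  {𝒜 : CartanTheory.{u, v} G} {Y : (OrbitCat G)ᵒᵖ ⥤ SSet.{u}}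
  (φ : OAction π 𝒜.M) {θ : Y ⟶ OWBar π}

/-- The differential as a map onto the cocycles. -/
def toZ (𝒜 : CartanTheory.{u, v} G) (m : ℕ) : 𝒜.A m ⟶ 𝒜.Z (m + 1) where
  app H :=
    { app := fun q => AddCommGrpCat.ofHom
        ((((𝒜.d m).app H).app q).hom.codRestrict (((𝒜.d (m + 1)).app H).app q).hom.ker fun x =>
          congrArg (fun t : (𝒜.A m).obj H ⟶ (𝒜.A (m + 2)).obj H => t.app q x)
            ((𝒜.dga H).d_comp_d m))
      naturality := fun p q f => by
        ext x
        exact Subtype.ext (((𝒜.d m).app H).naturality_apply f x) }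
  naturality K H g := kerS.hom_ext ((𝒜.d m).naturality g)

theorem toZ_surjective (m : ℕ) (H : (OrbitCat G)ᵒᵖ) (q : SimplexCategoryᵒᵖ) :
    Function.Surjective (((toZ 𝒜 m).app H).app q) := fun z => by
  obtain ⟨x, hx⟩ := (𝒜.exactness m H q z.1).1 z.2
  exact ⟨x, Subtype.ext hx⟩

theorem actA_toZ (m : ℕ) (H : (OrbitCat G)ᵒᵖ) (v : π.obj H) :
    ((actA φ m).ρ H v).hom ≫ (toZ 𝒜 m).app H =
      (toZ 𝒜 m).app H ≫ ((actZ φ (m + 1)).ρ H v).hom :=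
  kerS.hom_ext (actA_d φ m H v)

/-- Surjectivity of A^m → Z^{m+1} gives one direction and acyclicity of A^m the other. -/
theorem vertHomotopic_iff_exists_dbar (hY : CellExtension.IsCellular Y) (m : ℕ)
    (f f' : Lifts ((actZ φ (m + 1)).comp underlying) θ) :
    VertHomotopic f f' ↔ ∃ h : Lifts ((actA φ m).comp underlying) θ,
      f' - f = Lifts.push (toZ 𝒜 m) (actA_toZ φ m) h := by
  rw [Lifts.vertHomotopic_iff]
  constructor
  · rintro ⟨F, rfl, rfl⟩
    -- `D` is zero at the end 0. As Λ⁰[1], which is that end, is anodyne in Δ[1], `D` lifts through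
    -- δ with initial value 0; the value of the lift at the end 1 is the required cochain.
    let D := F - Lifts.cylinder (Lifts.endZero F)
    obtain ⟨t, -, ht⟩ := Lifts.exists_extension hY (SSet.horn.{u} 1 0) (toZ 𝒜 m) (actA_toZ φ m)
      (Or.inl ⟨SSet.anodyneExtensions.horn_ι 0, toZ_surjective m⟩) 0 D (by
        rw [map_zero]
        refine Lifts.ext_coeff fun H q z => Eq.symm ?_
        have e := ι₀_app_eq (Y.obj H) z.1 z.2.1 (eq_zero_of_mem_horn z.2.1 z.2.2)
        refine (Lifts.coeff_sub F _ H q (z.1, z.2.1)).trans ?_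
        refine sub_eq_zero.2 ?_
        rw [← e]
        rfl)
    refine ⟨Lifts.endOne t, ?_⟩
    rw [← Lifts.endOne_push, ht, map_sub, Lifts.endOne_cylinder]
  · rintro ⟨h, hh⟩
    -- The lift over both ends that is 0 at the end 0 and `h` at the end 1. Simplices of ∂Δ[1] are
    -- constant, so their first vertex tells the end.
    let c : Lifts ((actA φ m).comp underlying)
        (tensorFst Y (SSet.boundary.{u} 1 : SSet.{u}) ≫ θ) := Lifts.ofCoeff
      (fun H q z => if (SSet.stdSimplex.objEquiv z.2.1).toOrderHom 0 = 0 then 0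
        else h.coeff H q z.1)
      (fun H p q s z => by
        have e : (SSet.stdSimplex.objEquiv ((Δ[1] : SSet.{u}).map s z.2.1)).toOrderHom 0 =
          (SSet.stdSimplex.objEquiv z.2.1).toOrderHom 0 := eq_of_mem_boundary z.2.1 z.2.2 _ _
        change (if (SSet.stdSimplex.objEquiv ((Δ[1] : SSet.{u}).map s z.2.1)).toOrderHom 0 = 0
          then 0 else h.coeff H q ((Y.obj H).map s z.1)) = _
        rw [e]
        split_ifs
        · rw [map_zero, map_zero]
        · exact h.coeff_simplicial H s z.1)
      (fun {K H} g q z => by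
        change (if (SSet.stdSimplex.objEquiv z.2.1).toOrderHom 0 = 0
          then 0 else h.coeff H q ((Y.map g).app q z.1)) = _
        split_ifs
        · rw [map_zero]
        · exact h.coeff_natural g q z.1)
    obtain ⟨t, ht⟩ := Lifts.exists_extension_of_acyclic hY (SSet.boundary.{u} 1)
      (fun H n => 𝒜.homotopy_trivial m H n) c
    have ht' : ∀ H q (x : (Y.obj H).obj q) (k : (Δ[1] : SSet.{u}).obj q)
        (hk : k ∈ (SSet.boundary.{u} 1).obj q), t.coeff H q (x, k) =
          if (SSet.stdSimplex.objEquiv k).toOrderHom 0 = 0 then 0 else h.coeff H q x :=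
      fun H q x k hk => congrArg (fun z => z.coeff H q (x, ⟨k, hk⟩)) ht
    have h₀ : Lifts.endZero t = 0 := Lifts.ext_coeff fun H q x =>
      (ht' H q x (Prod.snd (SSet.ι₀.app q x : (Y.obj H).obj q × (Δ[1] : SSet.{u}).obj q))
        fun hs => zero_ne_one (hs 1).choose_spec).trans (if_pos rfl)
    have h₁ : Lifts.endOne t = h := Lifts.ext_coeff fun H q x =>
      (ht' H q x (Prod.snd (SSet.ι₁.app q x : (Y.obj H).obj q × (Δ[1] : SSet.{u}).obj q))
        fun hs => one_ne_zero (hs 0).choose_spec).trans (if_neg one_ne_zero)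
    -- The image of `t` under δ runs from 0 to f' − f; adding the constant homotopy at f shifts it
    -- to one from f to f'.
    refine ⟨Lifts.cylinder f + Lifts.push (toZ 𝒜 m) (actA_toZ φ m) t, ?_, ?_⟩
    · rw [map_add, Lifts.endZero_cylinder, Lifts.endZero_push, h₀, map_zero, add_zero]
    · rw [map_add, Lifts.endOne_cylinder, Lifts.endOne_push, h₁, ← hh, add_sub_cancel]

theorem aut_app_injective {A : SimplicialObject AddCommGrpCat.{u}} (α : Aut A)
    (q : SimplexCategoryᵒᵖ) : Function.Injective (α.hom.app q) :=
  Function.LeftInverse.injective (g := α.inv.app q) fun c =>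
    congrArg (fun (t : A ⟶ A) => t.app q c) α.hom_inv_id

/-- The coefficient on a face is the face of the coefficient up to a twisting automorphism. Both
operations are injective on Z^0, so a coefficient can be recovered from a face. -/
theorem coeff_face_injective (F : Lifts ((actZ φ 0).comp underlying) θ) (H : (OrbitCat G)ᵒᵖ) {q : ℕ}
    (i : Fin (q + 2)) {x y : (Y.obj H) _⦋q + 1⦌}
    (ht : Lifts.twist θ H (SimplexCategory.δ i).op x = Lifts.twist θ H (SimplexCategory.δ i).op y)
    (h : F.coeff H _ ((Y.obj H).map (SimplexCategory.δ i).op x) =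
      F.coeff H _ ((Y.obj H).map (SimplexCategory.δ i).op y)) :
    F.coeff H _ x = F.coeff H _ y := by
  rw [F.coeff_simplicial, F.coeff_simplicial, ht] at h
  have := 𝒜.isIso_δ H q i
  exact (ConcreteCategory.bijective_of_isIso (((𝒜.Z 0).obj H).δ i)).1
    (aut_app_injective ((actZ φ 0).ρ H (Lifts.twist θ H (SimplexCategory.δ i).op y)) (op ⦋q⦌) h)

/-- The two faces of a `1`-simplex of `Z^0𝒜` agree. -/
theorem Z_zero_face_eq (H : (OrbitCat G)ᵒᵖ) (e : ((𝒜.Z 0).obj H) _⦋1⦌) (i : Fin 2) :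
    ((𝒜.Z 0).obj H).σ 0 (((𝒜.Z 0).obj H).δ i e) = e := by
  have := 𝒜.isIso_σ H 0 0
  obtain ⟨c, rfl⟩ := (ConcreteCategory.bijective_of_isIso (((𝒜.Z 0).obj H).σ (0 : Fin 1))).2 e
  congr 1
  refine (ConcreteCategory.comp_apply _ _ c).symm.trans ?_
  obtain rfl | rfl : i = (0 : Fin 1).castSucc ∨ i = (0 : Fin 1).succ := by fin_cases i <;> simp
  · rw [SimplicialObject.δ_comp_σ_self]; rfl
  · rw [SimplicialObject.δ_comp_σ_succ]; rfl

theorem twist_degenerate (H : (OrbitCat G)ᵒᵖ) {p q : SimplexCategoryᵒᵖ} (t : op ⦋0⦌ ⟶ p) (s : p ⟶ q)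
    (y : (Y.obj H) _⦋0⦌) : Lifts.twist θ H s ((Y.obj H).map t y) = 1 := by
  refine Eq.trans ?_ (WBar.edge_refl (q := op ⦋0⦌) ((θ.app H).app _ y) 0)
  change WBar.edge ((θ.app H).app p ((Y.obj H).map t y)) _ = _
  rw [(θ.app H).naturality_apply]
  exact WBar.edge_congr (q := op ⦋0⦌) _ (Subsingleton.elim (α := Fin 1) _ _)
    (Subsingleton.elim (α := Fin 1) _ _) _ _

/-- The right side does not mention i, so F takes the same value at both ends over a vertex y. The
edge {y} × Δ[1] lies over a degenerate simplex, where the twist is trivial, and an edge of Z^0 is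
the degeneracy of either of its faces. -/
theorem coeff_cylinder_zero (F : Lifts ((actZ φ 0).comp underlying) (tensorFst Y Δ[1] ≫ θ))
    (H : (OrbitCat G)ᵒᵖ) (y : (Y.obj H) _⦋0⦌) (i : Fin 2) (k : (Δ[1] : SSet.{u}) _⦋0⦌)
    (hk : k = (Δ[1] : SSet.{u}).map (SimplexCategory.δ i).op (SSet.stdSimplex.objEquiv.symm (𝟙 _))) :
    ((𝒜.Z 0).obj H).σ 0 (F.coeff H (op ⦋0⦌) (y, k)) =
      F.coeff H (op ⦋1⦌)
        ((Y.obj H).map (SimplexCategory.σ 0).op y, SSet.stdSimplex.objEquiv.symm (𝟙 _)) := by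
  subst hk
  refine Eq.trans ?_ (Z_zero_face_eq H _ i)
  congr 1
  have hy : (Y.obj H).map (SimplexCategory.δ i).op ((Y.obj H).map (SimplexCategory.σ 0).op y) = y :=
    (map_op_congr' (Subsingleton.elim (α := ⦋0⦌ ⟶ ⦋0⦌) _ (𝟙 _)) y).trans
      ((Y.obj H).map_id_apply _ y)
  have h := F.coeff_simplicial H (SimplexCategory.δ i).op
    ((Y.obj H).map (SimplexCategory.σ 0).op y, SSet.stdSimplex.objEquiv.symm (𝟙 _))
  have ht : Lifts.twist (tensorFst Y Δ[1] ≫ θ) H (SimplexCategory.δ i).op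
    ((Y.obj H).map (SimplexCategory.σ (0 : Fin 1)).op y,
      SSet.stdSimplex.objEquiv.symm (𝟙 _)) = 1 := twist_degenerate H _ _ y
  rw [ht, map_one] at h
  refine Eq.trans ?_ h
  exact congrArg (F.coeff H (op ⦋0⦌)) (Prod.ext hy.symm rfl)

theorem twist_ι₀ (H : (OrbitCat G)ᵒᵖ) {p q : SimplexCategoryᵒᵖ} (s : p ⟶ q) (x : (Y.obj H).obj p) :
    Lifts.twist (tensorFst Y Δ[1] ≫ θ) H s (SSet.ι₀.app _ x) = Lifts.twist θ H s x := rfl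

theorem twist_ι₁ (H : (OrbitCat G)ᵒᵖ) {p q : SimplexCategoryᵒᵖ} (s : p ⟶ q) (x : (Y.obj H).obj p) :
    Lifts.twist (tensorFst Y Δ[1] ≫ θ) H s (SSet.ι₁.app _ x) = Lifts.twist θ H s x := rfl

theorem coeff_map_ι₀ (F : Lifts ((actZ φ 0).comp underlying) (tensorFst Y Δ[1] ≫ θ))
    (H : (OrbitCat G)ᵒᵖ) {p q : SimplexCategoryᵒᵖ} (s : p ⟶ q) (x : (Y.obj H).obj p) :
    F.coeff H q (((Y ⋙ tensorRight (Δ[1] : SSet.{u})).obj H).map s (SSet.ι₀.app _ x)) =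
      F.coeff H q (SSet.ι₀.app _ ((Y.obj H).map s x)) :=
  congrArg (F.coeff H q) ((SSet.ι₀ : Y.obj H ⟶ Y.obj H ⊗ Δ[1]).naturality_apply s x).symm

theorem coeff_map_ι₁ (F : Lifts ((actZ φ 0).comp underlying) (tensorFst Y Δ[1] ≫ θ))
    (H : (OrbitCat G)ᵒᵖ) {p q : SimplexCategoryᵒᵖ} (s : p ⟶ q) (x : (Y.obj H).obj p) :
    F.coeff H q (((Y ⋙ tensorRight (Δ[1] : SSet.{u})).obj H).map s (SSet.ι₁.app _ x)) =
      F.coeff H q (SSet.ι₁.app _ ((Y.obj H).map s x)) :=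
  congrArg (F.coeff H q) ((SSet.ι₁ : Y.obj H ⟶ Y.obj H ⊗ Δ[1]).naturality_apply s x).symm

/-- In degree zero vertically homotopic lifts agree. -/
theorem vertHomotopic_zero_iff (f f' : Lifts ((actZ φ 0).comp underlying) θ) :
    VertHomotopic f f' ↔ f = f' := by
  rw [Lifts.vertHomotopic_iff]
  constructor
  · rintro ⟨F, rfl, rfl⟩
    refine Lifts.ext_coeff fun H q x => ?_
    induction q using Opposite.rec with | _ q =>
    induction q using SimplexCategory.rec with | _ q =>
    change F.coeff H _ (SSet.ι₀.app _ x) = F.coeff H _ (SSet.ι₁.app _ x)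
    induction q with
    | zero =>
      have := 𝒜.isIso_σ H 0 0
      apply (ConcreteCategory.bijective_of_isIso (((𝒜.Z 0).obj H).σ (0 : Fin 1))).1
      -- The face ∂₁ of the edge is its vertex 0, hence the crossed indices.
      refine (coeff_cylinder_zero φ F H x 1 _ ?_).trans (coeff_cylinder_zero φ F H x 0 _ ?_).symm
      · apply SSet.stdSimplex.objEquiv.injective
        ext i
        fin_cases i
        rfl
      · apply SSet.stdSimplex.objEquiv.injective
        ext i
        fin_cases i
        rfl
    | succ q ih =>
      -- Both ends lie over the same base simplex and so have the same twist; equality on ∂₀ then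
      -- propagates upwards.
      exact coeff_face_injective φ F H 0 ((twist_ι₀ H _ x).trans (twist_ι₁ H _ x).symm)
        ((coeff_map_ι₀ φ F H _ x).trans ((ih _).trans (coeff_map_ι₁ φ F H _ x).symm))
  · rintro rfl
    exact ⟨Lifts.cylinder f, rfl, rfl⟩

end VerticalHomotopy

/-! ### Comparison with the homology of the lift complex -/

section Cohomology

variable {G : Type v} [Group G] {𝒜 : CartanTheory.{u, v} G} {π : (OrbitCat G)ᵒᵖ ⥤ GrpCat.{u}}
  {B : (OrbitCat G)ᵒᵖ ⥤ SSet.{u}} (φ : OAction π 𝒜.M) (τ : OTwisting B π)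

theorem toLift_injective (n : ℕ) : Function.Injective (toLift φ τ n) := fun _ _ h =>
  Lifts.ext_coeff fun H q x => Subtype.ext (congrArg (fun z => Lifts.coeff z H q x) h)

theorem exists_toLift_eq (n : ℕ) (f : LiftGroup φ τ n) (hf : dbar φ τ n f = 0) :
    ∃ z, toLift φ τ n z = f :=
  ⟨Lifts.ofCoeff (T := 𝒜.Z n)
      (fun H q x => ⟨f.coeff H q x, congrArg (fun z => Lifts.coeff z H q x) hf⟩)
      (fun H _ _ s x => Subtype.ext (f.coeff_simplicial H s x))
      (fun g q x => Subtype.ext (f.coeff_natural g q x)),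
    Lifts.ext_coeff fun _ _ _ => rfl⟩

/-- The cocycle of a lift to the cocycles. -/
noncomputable def toCycle (n : ℕ) : AddCommGrpCat.of (ZLifts φ τ n) ⟶ (liftComplex φ τ).cycles n :=
  (liftComplex φ τ).liftCycles (A := AddCommGrpCat.of (ZLifts φ τ n))
    (AddCommGrpCat.ofHom (toLift φ τ n)) (n + 1) (by simp)
    (by
      refine (congrArg (AddCommGrpCat.ofHom (toLift φ τ n) ≫ ·) (liftComplex_d φ τ n)).trans ?_
      ext f
      exact dbar_toLift φ τ n f)

theorem iCycles_toCycle (n : ℕ) (f : ZLifts φ τ n) :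
    (liftComplex φ τ).iCycles n (toCycle φ τ n f) = toLift φ τ n f :=
  congrArg (fun t : AddCommGrpCat.of (ZLifts φ τ n) ⟶ (liftComplex φ τ).X n => t f)
    ((liftComplex φ τ).liftCycles_i _ _ _ _)

theorem iCycles_injective (n : ℕ) : Function.Injective ((liftComplex φ τ).iCycles n) :=
  (AddCommGrpCat.mono_iff_injective _).1 inferInstance

theorem toCycle_surjective (n : ℕ) : Function.Surjective (toCycle φ τ n) := fun z => by
  obtain ⟨f, hf⟩ := exists_toLift_eq φ τ n ((liftComplex φ τ).iCycles n z) (by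
    have h := congrArg (fun t : (liftComplex φ τ).cycles n ⟶ (liftComplex φ τ).X (n + 1) => t z)
      ((liftComplex φ τ).iCycles_d n (n + 1))
    rw [liftComplex_d] at h
    exact h)
  exact ⟨f, iCycles_injective φ τ n ((iCycles_toCycle φ τ n f).trans hf)⟩

theorem cohomologyClass_surjective (n : ℕ) : Function.Surjective (cohomologyClass φ τ n) :=
  fun c => by
    obtain ⟨z, rfl⟩ := (AddCommGrpCat.epi_iff_surjective ((liftComplex φ τ).homologyπ n)).1
      inferInstance c
    obtain ⟨f, rfl⟩ := toCycle_surjective φ τ n z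
    exact ⟨f, rfl⟩

/-- Homology is the cokernel of the map from X_i to the cycles, and cycles embed in X_n. Leaving i
as a parameter treats n = 0 and n > 0 together. -/
theorem cohomologyClass_eq_zero_iff (n i : ℕ) (hi : (ComplexShape.up ℕ).prev n = i)
    (f : ZLifts φ τ n) : cohomologyClass φ τ n f = 0 ↔
      ∃ h : (liftComplex φ τ).X i, (liftComplex φ τ).d i n h = toLift φ τ n f := by
  have hex : Function.Exact ((liftComplex φ τ).toCycles i n) ((liftComplex φ τ).homologyπ n) :=
    (ShortComplex.ab_exact_iff_function_exact _).1 (ShortComplex.exact_of_g_is_cokernel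
      (ShortComplex.mk _ _ ((liftComplex φ τ).toCycles_comp_homologyπ i n))
      ((liftComplex φ τ).homologyIsCokernel i n hi))
  have hi' : ∀ h, (liftComplex φ τ).iCycles n ((liftComplex φ τ).toCycles i n h) =
      (liftComplex φ τ).d i n h := fun h =>
    congrArg (fun t : (liftComplex φ τ).X i ⟶ (liftComplex φ τ).X n => t h)
      ((liftComplex φ τ).toCycles_i i n)
  refine (hex (toCycle φ τ n f)).trans ⟨?_, ?_⟩
  · rintro ⟨h, hh⟩
    exact ⟨h, by rw [← hi', hh, iCycles_toCycle]⟩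
  · rintro ⟨h, hh⟩
    exact ⟨h, iCycles_injective φ τ n (by rw [hi', hh, iCycles_toCycle])⟩

theorem vertHomotopic_iff_cohomologyClass_eq (hB : CellExtension.IsCellular B) (n : ℕ)
    (f f' : ZLifts φ τ n) :
    VertHomotopic f f' ↔ cohomologyClass φ τ n f = cohomologyClass φ τ n f' := by
  -- A homotopy from f to f' makes f' − f a coboundary, so the equality is turned round before
  -- subtracting.
  rw [eq_comm, ← sub_eq_zero, ← map_sub]
  obtain _ | m := n
  -- The predecessor of 0 is 0 by convention and the differential from degree 0 to itself is zero,
  -- so only the zero cocycle has zero class.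
  · rw [vertHomotopic_zero_iff, cohomologyClass_eq_zero_iff φ τ 0 0 (by simp),
      (liftComplex φ τ).shape 0 0 (by simp)]
    constructor
    · rintro rfl
      exact ⟨0, by rw [sub_self, map_zero]; rfl⟩
    · rintro ⟨h, hh⟩
      exact (sub_eq_zero.1 (toLift_injective φ τ 0 (hh.symm.trans (map_zero _).symm))).symm
  · rw [vertHomotopic_iff_exists_dbar φ hB, cohomologyClass_eq_zero_iff φ τ (m + 1) m (by simp),
      liftComplex_d]
    exact exists_congr fun h => ⟨fun e => (congrArg (toLift φ τ (m + 1)) e).symm,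
      fun e => toLift_injective φ τ (m + 1) e.symm⟩

end Cohomology

end CartanTheory

theorem proposition4p4 {G : Type v} [Group G] (𝒜 : CartanTheory.{u, v} G)
    (X : Action SSet.{u} G) (π : (OrbitCat G)ᵒᵖ ⥤ GrpCat.{u}) (τ : OTwisting (Phi X) π)
    (φ : OAction π 𝒜.M) (n : ℕ) :
    _root_.Equivalence (VertHomotopic : CartanTheory.ZLifts φ τ n → CartanTheory.ZLifts φ τ n → Prop) ∧
    ∃ e : (CartanTheory.liftComplex φ τ).homology n ≃
        Quot (VertHomotopic : CartanTheory.ZLifts φ τ n → CartanTheory.ZLifts φ τ n → Prop),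
      ∀ f : CartanTheory.ZLifts φ τ n,
        e (CartanTheory.cohomologyClass φ τ n f) = Quot.mk VertHomotopic f := by
  have key := CartanTheory.vertHomotopic_iff_cohomologyClass_eq φ τ (isCellular_Phi X) n
  refine ⟨⟨fun f => (key f f).2 rfl, fun h => (key _ _).2 ((key _ _).1 h).symm,
    fun h h' => (key _ _).2 (((key _ _).1 h).trans ((key _ _).1 h'))⟩, ?_⟩
  -- The class map descends to homotopy classes by one direction of `key` and is injective there by
  -- the other. The required bijection is its inverse.
  let e := Equiv.ofBijective
    (Quot.lift (CartanTheory.cohomologyClass φ τ n) fun f f' h => (key f f').1 h)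
    ⟨by
      rintro ⟨f⟩ ⟨f'⟩ h
      exact Quot.sound ((key f f').2 h),
    fun c => by
      obtain ⟨f, rfl⟩ := CartanTheory.cohomologyClass_surjective φ τ n c
      exact ⟨Quot.mk _ f, rfl⟩⟩
  exact ⟨e.symm, fun f => (Equiv.symm_apply_eq e).2 rfl⟩
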